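/- Let $K$ be a field of characteristic zero and let $A_n(K)$ be the Weyl algebra generated over $K$ by $x_1,\dots,x_n,\partial_1,\dots,\partial_n$ with the relations $x_ix_j=x_jx_i$, $\partial_i\partial_j=\partial_j\partial_i$, $\partial_ix_j=x_j\partial_i$ for $i\neq j$, and $\partial_ix_i=x_i\partial_i+1$. Fix a partition of $\{1,\dots,n\}$ into $p$ blocks $N_1,\dots,N_p$ (empty blocks are allowed) and put $n_j=|N_j|$. For $r\in\mathbb{Z}^p$ let $W_r$ be the $K$-linear span of the monomials $x^\alpha\partial^\beta$ with $\sum_{i\in N_j}(\alpha_i+\beta_i)\le r_j$ for $j=1,\dots,p$ (so $W_r=0$ if some $r_j<0$). Let $M$ be a finitely generated left $A_n(K)$-module. For a finite system of generators $f=(f_1,\dots,f_m)$ of $M$, the dimension polynomial of $M$ associated with $f$ is the polynomial $\phi_M\in\mathbb{Q}[t_1,\dots,t_p]$ such that $\phi_M(r)=\dim_K\sum_{i=1}^mW_rf_i$ for all sufficiently large $r\in\mathbb{Z}^p$ (that is, for all $r$ with $r_j\ge s_j$, $1\le j\le p$, for some $s\in\mathbb{Z}^p$). **Theorem 4.4.**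 For every finite system of generators of $M$ there is exactly one associated dimension polynomial, and it can be written in exactly one way as $$\phi_M(t_1,\dots,t_p)=\sum_{i_1=0}^{2n_1}\cdots\sum_{i_p=0}^{2n_p}a_{i_1\dots i_p}\binom{t_1+i_1}{i_1}\cdots\binom{t_p+i_p}{i_p}$$ with integers $a_{i_1\dots i_p}$. Let $S(\phi_M)=\{(i_1,\dots,i_p): a_{i_1\dots i_p}\ne 0\}$, and let $S(\phi_M)'$ be the set of those elements of $S(\phi_M)$ that are maximal in $S(\phi_M)$ for at least one of the $p!$ lexicographic orders on $\mathbb{N}^p$ (one for each order in which the coordinates can be compared). Then the following do not depend on the finite system of generators of $M$ with which $\phi_M$ is associated: 1. the total degree $d=\deg\phi_M$; 2. the coefficient $a_{2n_1,\dots,2n_p}$; likewise the degrees $D_j=\deg_{t_j}\phi_M$ ($1\le j\le p$) and the coefficient $a_{D_1,\dots,D_p}$; 3. the set $S(\phi_M)'$ and the coefficients $a_{k_1\dots k_p}$ with $(k_1,\dots,k_p)\in S(\phi_M)'$; 4. the coefficients of the terms of total degree $d$, that is, the $a_{k_1\dots k_p}$ with $k_1+\dots+k_p=d$, and likewise the coefficients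 of the monomials $t_1^{k_1}\cdots t_p^{k_p}$ with $k_1+\dots+k_p=d$ in $\phi_M$. (The degrees of the zero polynomial are taken to be $0$.) -/

import Mathlib

noncomputable section

namespace WeylDim

/-- The defining relations of the `n`-th Weyl algebra; `Sum.inl i` stands for the variable `x i`
and `Sum.inr i` for the partial derivative `∂ i`. -/
inductive Rel (K : Type*) [Field K] (n : ℕ) :
    FreeAlgebra K (Fin n ⊕ Fin n) → FreeAlgebra K (Fin n ⊕ Fin n) → Prop
  | x_comm (i j : Fin n) :
      Rel K n (FreeAlgebra.ι K (Sum.inl i) * FreeAlgebra.ι K (Sum.inl j))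
        (FreeAlgebra.ι K (Sum.inl j) * FreeAlgebra.ι K (Sum.inl i))
  | d_comm (i j : Fin n) :
      Rel K n (FreeAlgebra.ι K (Sum.inr i) * FreeAlgebra.ι K (Sum.inr j))
        (FreeAlgebra.ι K (Sum.inr j) * FreeAlgebra.ι K (Sum.inr i))
  | d_x_of_ne (i j : Fin n) (hij : i ≠ j) :
      Rel K n (FreeAlgebra.ι K (Sum.inr i) * FreeAlgebra.ι K (Sum.inl j))
        (FreeAlgebra.ι K (Sum.inl j) * FreeAlgebra.ι K (Sum.inr i))
  | d_x (i : Fin n) :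
      Rel K n (FreeAlgebra.ι K (Sum.inr i) * FreeAlgebra.ι K (Sum.inl i))
        (FreeAlgebra.ι K (Sum.inl i) * FreeAlgebra.ι K (Sum.inr i) + 1)

/-- The Weyl algebra `A_n(K)`, by generators and relations. -/
abbrev WeylAlgebra (K : Type*) [Field K] (n : ℕ) := RingQuot (Rel K n)

/-- The generator `x i` of `A_n(K)`. -/
def x (K : Type*) [Field K] {n : ℕ} (i : Fin n) : WeylAlgebra K n :=
  RingQuot.mkAlgHom K (Rel K n) (FreeAlgebra.ι K (Sum.inl i))

/-- The generator `∂ i` of `A_n(K)`. -/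
def d (K : Type*) [Field K] {n : ℕ} (i : Fin n) : WeylAlgebra K n :=
  RingQuot.mkAlgHom K (Rel K n) (FreeAlgebra.ι K (Sum.inr i))

/-- The monomial `x^α ∂^β = x_1^{α_1} ⋯ x_n^{α_n} ∂_1^{β_1} ⋯ ∂_n^{β_n}`. -/
def mono (K : Type*) [Field K] {n : ℕ} (α β : Fin n → ℕ) : WeylAlgebra K n :=
  (List.ofFn fun i => x K i ^ α i).prod * (List.ofFn fun i => d K i ^ β i).prod

/-- The number of variables in the `j`-th block of the partition of `{x_1, …, x_n}` in which
`x i` lies in the block `c i`. -/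
def blockSize {n p : ℕ} (c : Fin n → Fin p) (j : Fin p) : ℕ :=
  (Finset.univ.filter fun i => c i = j).card

/-- The `j`-th order of the monomial `x^α ∂^β`: its degree in the variables and the partial
derivatives of the `j`-th block. -/
def ordMono {n p : ℕ} (c : Fin n → Fin p) (j : Fin p) (α β : Fin n → ℕ) : ℕ :=
  ∑ i ∈ Finset.univ.filter (fun i => c i = j), (α i + β i)

/-- The component `W_r` of the `p`-dimensional filtration of `A_n(K)`: the `K`-span of the
monomials of `j`-th order at most `r j` for all `j`. If some `r j` is negative there is no such
monomial, and `W_r = 0`. -/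
def W (K : Type*) [Field K] {n p : ℕ} (c : Fin n → Fin p) (r : Fin p → ℤ) :
    Submodule K (WeylAlgebra K n) :=
  Submodule.span K
    {D | ∃ α β : Fin n → ℕ, (∀ j, (ordMono c j α β : ℤ) ≤ r j) ∧ D = mono K α β}

/-- The component `M_r = ∑ i, W_r • f i` of the filtration of a `D`-module that is associated with
the family `f`. -/
def filt (K : Type*) [Field K] {n p : ℕ} (c : Fin n → Fin p)
    {M : Type*} [AddCommGroup M] [Module K M] [Module (WeylAlgebra K n) M]
    [IsScalarTower K (WeylAlgebra K n) M] {m : ℕ} (f : Fin m → M) (r : Fin p → ℤ) :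
    Submodule K M :=
  ⨆ i, (W K c r).map ((LinearMap.toSpanSingleton (WeylAlgebra K n) M (f i)).restrictScalars K)

/-- `φ` is the dimension polynomial associated with the family `f`:
`φ(r) = dim_K M_r` for all sufficiently large `r ∈ ℤ^p`. -/
def IsDimensionPolynomial (K : Type*) [Field K] {n p : ℕ} (c : Fin n → Fin p)
    {M : Type*} [AddCommGroup M] [Module K M] [Module (WeylAlgebra K n) M]
    [IsScalarTower K (WeylAlgebra K n) M] {m : ℕ} (f : Fin m → M)
    (φ : MvPolynomial (Fin p) ℚ) : Prop :=
  ∃ s : Fin p → ℤ, ∀ r : Fin p → ℤ, s ≤ r →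
    MvPolynomial.eval (fun j => (r j : ℚ)) φ = (Module.finrank K (filt K c f r) : ℚ)

/-- The polynomial `(t_j + k choose k) = (t_j + 1)(t_j + 2) ⋯ (t_j + k) / k!`. -/
def binom {p : ℕ} (j : Fin p) (k : ℕ) : MvPolynomial (Fin p) ℚ :=
  MvPolynomial.C ((k.factorial : ℚ)⁻¹) *
    ∏ l ∈ Finset.range k, (MvPolynomial.X j + MvPolynomial.C ((l : ℚ) + 1))

/-- `φ = ∑ a_k ∏ j, (t_j + k_j choose k_j)`, the sum being over all `k` with
`0 ≤ k_j ≤ 2 n_j`, with integer coefficients `a_k`. -/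
def HasExpansion {n p : ℕ} (c : Fin n → Fin p) (φ : MvPolynomial (Fin p) ℚ)
    (a : (Fin p → ℕ) →₀ ℤ) : Prop :=
  (∀ k ∈ a.support, ∀ j, k j ≤ 2 * blockSize c j) ∧
    φ = ∑ k ∈ a.support, MvPolynomial.C (a k : ℚ) * ∏ j, binom j (k j)

/-- The elements of `S ⊆ ℕ^p` that are maximal in `S` for at least one of the `p!` lexicographic
orders, which compare the coordinates in the order `σ 0, σ 1, …` for a permutation `σ`. -/
def lexMaximal {p : ℕ} (S : Set (Fin p → ℕ)) : Set (Fin p → ℕ) :=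
  {k | k ∈ S ∧ ∃ σ : Equiv.Perm (Fin p), ∀ l ∈ S, toLex (l ∘ σ) ≤ toLex (k ∘ σ)}

end WeylDim

end

/-
Order the elements `x^α ∂^β f_i` so that left multiplication by a generator of `A_n(K)` raises the
leading exponent by one unit vector. Recording for each of them the degrees `r` in which it is not
a combination of smaller elements of `M_r` gives a set of exponents in twice the number of
variables plus `p`, and it is closed downwards, so it is a finite disjoint union of cones
`a + ℕ^S`. Hence `dim_K M_r` is a sum of products of binomial coefficients for large `r`.

The filtrations of two families with the same span lie in each other up to a shift of `r`.
Their polynomials therefore dominate each other up to shifts, which forces the leading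
forms with respect to every positive weight on the variables to coincide. The total degree
corresponds to the weight `(1, …, 1)`; a maximum for a lexicographic order is the unique maximum
for a weight that decreases fast enough, and there only one binomial product contributes.
-/

noncomputable section

namespace WeylDim

section StanleyDecomposition

variable {ι : Type*}

/-- The translated coordinate orthant `a + ℕ^S` in the space of exponents. -/
def cone (a : ι → ℕ) (S : Finset ι) : Set (ι → ℕ) :=
  {ξ | a ≤ ξ ∧ ∀ v ∉ S, ξ v = a v}

/-- The sets of exponents that are finite disjoint unions of cones `a + ℕ^S`, that is, the sets
that admit a Stanley decomposition. -/
inductive HasStanleyDecomposition : Set (ι → ℕ) → Prop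
  | empty : HasStanleyDecomposition ∅
  | cone (a : ι → ℕ) (S : Finset ι) : HasStanleyDecomposition (cone a S)
  | union {D E : Set (ι → ℕ)} :
      HasStanleyDecomposition D → HasStanleyDecomposition E → Disjoint D E →
        HasStanleyDecomposition (D ∪ E)

namespace HasStanleyDecomposition

lemma preimage_comp_equiv {κ : Type*} {D : Set (ι → ℕ)} (hD : HasStanleyDecomposition D)
    (e : ι ≃ κ) : HasStanleyDecomposition ((fun ξ : κ → ℕ => ξ ∘ e) ⁻¹' D) := by
  induction hD with
  | empty => exact empty
  | cone a S =>
    convert HasStanleyDecomposition.cone (a ∘ e.symm) (S.map e.toEmbedding)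
    ext ξ
    simp [WeylDim.cone, Pi.le_def, e.forall_congr_left]
  | union _ _ hDE ihD ihE => exact ihD.union ihE (hDE.preimage _)

variable {N : ℕ} {D : Set (Fin N → ℕ)}

lemma setOf_head_eq_tail_mem (hD : HasStanleyDecomposition D) (k : ℕ) :
    HasStanleyDecomposition {ξ : Fin (N + 1) → ℕ | ξ 0 = k ∧ Fin.tail ξ ∈ D} := by
  induction hD with
  | empty => simpa using empty
  | cone a S =>
    convert HasStanleyDecomposition.cone (Fin.cons k a) (S.map (Fin.succEmb N))
    ext ξ
    simp only [WeylDim.cone, Pi.le_def, Fin.forall_fin_succ, Set.mem_ofPred_eq, Fin.tail,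
      Fin.cons_zero, Fin.cons_succ, Finset.mem_map, Fin.coe_succEmb, Fin.succ_inj,
      exists_eq_right, Fin.succ_ne_zero, and_false, exists_false, not_false_eq_true, forall_const]
    grind
  | union _ _ hDE ihD ihE =>
    convert ihD.union ihE (Set.disjoint_left.2 fun ξ h h' => Set.disjoint_left.1 hDE h.2 h'.2)
    ext ξ
    simp [and_or_left]

lemma setOf_le_head_tail_mem (hD : HasStanleyDecomposition D) (k : ℕ) :
    HasStanleyDecomposition {ξ : Fin (N + 1) → ℕ | k ≤ ξ 0 ∧ Fin.tail ξ ∈ D} := by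
  induction hD with
  | empty => simpa using empty
  | cone a S =>
    convert HasStanleyDecomposition.cone (Fin.cons k a) (insert 0 (S.map (Fin.succEmb N)))
    ext ξ
    simp only [WeylDim.cone, Pi.le_def, Fin.forall_fin_succ, Set.mem_ofPred_eq, Fin.tail,
      Fin.cons_zero, Fin.cons_succ, Finset.mem_insert, Finset.mem_map, Fin.coe_succEmb,
      Fin.succ_inj, exists_eq_right, Fin.succ_ne_zero, false_or, true_or, not_true_eq_false,
      IsEmpty.forall_iff, true_and]
    grind
  | union _ _ hDE ihD ihE =>
    convert ihD.union ihE (Set.disjoint_left.2 fun ξ h h' => Set.disjoint_left.1 hDE h.2 h'.2)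
    ext ξ
    simp [and_or_left]

end HasStanleyDecomposition

lemma exists_forall_ge_eq_of_antitone {α : Type*} [Preorder α] [WellQuasiOrderedLE α]
    {D : ℕ → Set α} (hD : ∀ k, IsLowerSet (D k)) (hanti : Antitone D) :
    ∃ k₀, ∀ k, k₀ ≤ k → D k = D k₀ := by
  by_contra! hne
  choose next le_next next_ne using hne
  have hex : ∀ k, ∃ a ∈ D k, a ∉ D (next k) := fun k => by
    by_contra! h
    exact next_ne k ((hanti (le_next k)).antisymm h)
  choose a mem_D notMem_D using hex
  have iterate_succ : ∀ i, next^[i + 1] 0 = next (next^[i] 0) :=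
    fun i => Function.iterate_succ_apply' _ _ _
  have hmono : Monotone fun i => next^[i] 0 :=
    monotone_nat_of_le_succ fun i => by simpa only [iterate_succ] using le_next _
  obtain ⟨i, j, hij, hle⟩ := wellQuasiOrdered_le fun i => a (next^[i] 0)
  refine notMem_D (next^[i] 0) ?_
  rw [← iterate_succ]
  exact hanti (hmono hij) (hD _ hle (mem_D _))

lemma hasStanleyDecomposition_fin {N : ℕ} {D : Set (Fin N → ℕ)} (hD : IsLowerSet D) :
    HasStanleyDecomposition D := by
  induction N with
  | zero =>
    obtain rfl | hne := D.eq_empty_or_nonempty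
    · exact .empty
    · convert HasStanleyDecomposition.cone (0 : Fin 0 → ℕ) ∅
      rw [Subsingleton.eq_univ_of_nonempty hne, eq_comm, Set.eq_univ_iff_forall]
      simp [cone]
  | succ N ih =>
    let slice (k : ℕ) : Set (Fin N → ℕ) := {ξ | Fin.cons k ξ ∈ D}
    have hslice : ∀ k, IsLowerSet (slice k) := fun k ξ η hle hξ =>
      hD (Fin.cons_le_cons.2 ⟨le_rfl, hle⟩) hξ
    have hanti : Antitone slice := fun k l hkl ξ hξ => hD (Fin.cons_le_cons.2 ⟨hkl, le_rfl⟩) hξ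
    have mem_iff : ∀ ξ : Fin (N + 1) → ℕ, ξ ∈ D ↔ Fin.tail ξ ∈ slice (ξ 0) := fun ξ => by
      rw [Set.mem_ofPred_eq, Fin.cons_self_tail]
    obtain ⟨k₀, hk₀⟩ := exists_forall_ge_eq_of_antitone hslice hanti
    have hge : ∀ k ≤ k₀, HasStanleyDecomposition {ξ | k ≤ ξ 0 ∧ ξ ∈ D} := fun k hk => by
      induction hk using Nat.decreasingInduction with
      | self =>
        convert (ih (hslice k₀)).setOf_le_head_tail_mem k₀ using 3 with ξ
        exact and_congr_right fun h => by rw [mem_iff, hk₀ _ h]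
      | of_succ k _ ih' =>
        convert ((ih (hslice k)).setOf_head_eq_tail_mem k).union ih' ?_
        · ext ξ
          have : ξ 0 = k → (ξ ∈ D ↔ Fin.tail ξ ∈ slice k) := fun h => by rw [mem_iff, h]
          simp only [Set.mem_ofPred_eq, Set.mem_union]
          grind
        · exact Set.disjoint_left.2 fun ξ h h' => by simp only [Set.mem_ofPred_eq] at h h'; omega
    simpa using hge 0 k₀.zero_le

lemma hasStanleyDecomposition_of_isLowerSet [Finite ι] {D : Set (ι → ℕ)} (hD : IsLowerSet D) :
    HasStanleyDecomposition D := by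
  let e := Finite.equivFin ι
  have h := hasStanleyDecomposition_fin
    (D := (fun ξ : Fin (Nat.card ι) → ℕ => ξ ∘ e) ⁻¹' D)
    fun ξ η hle hξ => hD (fun v => hle (e v)) hξ
  convert h.preimage_comp_equiv e.symm
  ext ξ
  simp [Function.comp_assoc]

end StanleyDecomposition

section Multidegree

open Finset

variable {ι τ : Type*} [Fintype ι] [DecidableEq τ] (c : ι → τ)

/-- The multidegree of the monomial with exponent `ξ`, where the variable `v` has
degree `e_{c v}`. -/
def multidegree : (ι → ℕ) →+ (τ → ℕ) where
  toFun ξ j := ∑ v with c v = j, ξ v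
  map_zero' := by ext; simp
  map_add' ξ η := by ext; simp [sum_add_distrib]

lemma multidegree_apply (ξ : ι → ℕ) (j : τ) : multidegree c ξ j = ∑ v with c v = j, ξ v :=
  rfl

lemma multidegree_mono : Monotone (multidegree c) :=
  fun _ _ h _ => sum_le_sum fun v _ => h v

lemma le_multidegree (ξ : ι → ℕ) (v : ι) : ξ v ≤ multidegree c ξ (c v) :=
  single_le_sum (f := ξ) (fun _ _ => Nat.zero_le _) (by simp)

lemma finite_setOf_multidegree_le (r : τ → ℕ) : {ξ | multidegree c ξ ≤ r}.Finite :=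
  (Set.Finite.pi' fun v => Set.finite_Iic (r (c v))).subset fun ξ hξ v =>
    (le_multidegree c ξ v).trans (hξ _)

/-- The Hilbert function of the set `D` of exponents: the number of elements of `D` of
multidegree `r`. -/
def hilb (D : Set (ι → ℕ)) (r : τ → ℕ) : ℕ :=
  {ξ ∈ D | multidegree c ξ = r}.ncard

lemma hilb_union {D E : Set (ι → ℕ)} (hDE : Disjoint D E) (r : τ → ℕ) :
    hilb c (D ∪ E) r = hilb c D r + hilb c E r := by
  have hfin : ∀ D : Set (ι → ℕ), {ξ ∈ D | multidegree c ξ = r}.Finite := fun D =>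
    (finite_setOf_multidegree_le c r).subset fun ξ hξ => hξ.2.le
  rw [hilb, hilb, hilb, ← Set.ncard_union_eq (hDE.mono (Set.sep_subset _ _) (Set.sep_subset _ _))
    (hfin D) (hfin E)]
  congr 1
  ext ξ
  simp [or_and_right]

lemma ncard_setOf_multidegree_eq [Fintype τ] (S : Finset ι) (r : τ → ℕ) :
    {ξ : ι → ℕ | (∀ v ∉ S, ξ v = 0) ∧ multidegree c ξ = r}.ncard =
      ∏ j, (#{v ∈ S | c v = j}).multichoose (r j) := by
  classical
  let pieces := Fintype.piFinset fun j => piAntidiag {v ∈ S | c v = j} (r j)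
  let glue (F : τ → ι → ℕ) (v : ι) : ℕ := F (c v) v
  have mem_pieces : ∀ {F}, F ∈ pieces ↔
      ∀ j, ∑ v ∈ S with c v = j, F j v = r j ∧ ∀ v, F j v ≠ 0 → v ∈ S ∧ c v = j := by
    simp [pieces]
  have glue_injOn : Set.InjOn glue pieces := fun F hF G hG h => by
    rw [mem_coe, mem_pieces] at hF hG
    ext j v
    obtain rfl | hv := eq_or_ne (c v) j
    · exact congrFun h v
    · rw [of_not_not fun h => hv ((hF j).2 v h).2, of_not_not fun h => hv ((hG j).2 v h).2]
  have sum_eq : ∀ ξ : ι → ℕ, (∀ v ∉ S, ξ v = 0) → ∀ j,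
      ∑ v ∈ S with c v = j, ξ v = multidegree c ξ j := fun ξ hξ j =>
    sum_subset (filter_subset_filter _ (subset_univ S)) fun v hv hvS => hξ v fun h =>
      hvS (mem_filter.2 ⟨h, (mem_filter.1 hv).2⟩)
  have image_glue : glue '' pieces = {ξ | (∀ v ∉ S, ξ v = 0) ∧ multidegree c ξ = r} := by
    ext ξ
    constructor
    · rintro ⟨F, hF, rfl⟩
      rw [mem_coe, mem_pieces] at hF
      have hS : ∀ v ∉ S, glue F v = 0 := fun v hv => of_not_not fun h => hv ((hF _).2 v h).1
      refine ⟨hS, funext fun j => ?_⟩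
      rw [← sum_eq _ hS, ← (hF j).1]
      exact sum_congr rfl fun v hv => by rw [← (mem_filter.1 hv).2]
    · rintro ⟨hS, rfl⟩
      refine ⟨fun j v => if c v = j then ξ v else 0, mem_pieces.2 fun j => ⟨?_, fun v hv => ?_⟩,
        funext fun v => if_pos rfl⟩
      · rw [← sum_eq ξ hS]
        exact sum_congr rfl fun v hv => if_pos (mem_filter.1 hv).2
      · grind
  rw [← image_glue, glue_injOn.ncard_image, Set.ncard_coe_finset,
    Fintype.card_piFinset]
  refine prod_congr rfl fun j _ => ?_
  rw [← card_finsuppAntidiag_nat_eq_multichoose]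
  simp [finsuppAntidiag]

lemma hilb_cone [Fintype τ] (a : ι → ℕ) (S : Finset ι) {r : τ → ℕ} (hr : multidegree c a ≤ r) :
    hilb c (cone a S) r =
      ∏ j, (#{v ∈ S | c v = j}).multichoose (r j - multidegree c a j) := by
  have image_add : {ξ ∈ cone a S | multidegree c ξ = r} = (a + ·) ''
      {η | (∀ v ∉ S, η v = 0) ∧ multidegree c η = r - multidegree c a} := by
    ext ξ
    constructor
    · rintro ⟨⟨hle, hS⟩, rfl⟩
      obtain ⟨η, rfl⟩ := exists_add_of_le hle
      exact ⟨η, ⟨fun v hv => by simpa using hS v hv, by rw [map_add, add_tsub_cancel_left]⟩, rfl⟩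
    · rintro ⟨η, ⟨hS, hη⟩, rfl⟩
      exact ⟨⟨le_self_add, fun v hv => by simp [hS v hv]⟩,
        by rw [map_add, hη, add_tsub_cancel_of_le hr]⟩
  rw [hilb, image_add, Set.ncard_image_of_injective _ (add_right_injective a),
    ncard_setOf_multidegree_eq]
  rfl

end Multidegree

section HilbertPolynomial

open Filter Finset MvPolynomial

variable {p : ℕ}

lemma eval_binom (j : Fin p) (k : ℕ) (r : Fin p → ℕ) :
    eval (fun i => (r i : ℚ)) (binom j k) = (r j + k).choose k := by
  have hasc : ∏ l ∈ range k, ((r j : ℚ) + (l + 1)) = (r j + 1).ascFactorial k := by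
    rw [Nat.ascFactorial_eq_prod_range]
    push_cast
    exact prod_congr rfl fun l _ => by ring
  simp only [binom, map_mul, map_prod, map_add, eval_C, eval_X, hasc,
    Nat.ascFactorial_eq_factorial_mul_choose, Nat.cast_mul]
  exact inv_mul_cancel_left₀ (by exact_mod_cast k.factorial_ne_zero) _

lemma exists_mem_span_binom_eval_eq_multichoose (j : Fin p) (s a : ℕ) :
    ∃ ψ ∈ Submodule.span ℤ (binom j '' Set.Iio s), ∀ r : Fin p → ℕ, a < r j →
      eval (fun i => (r i : ℚ)) ψ = s.multichoose (r j - a) := by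
  induction s generalizing a with
  | zero =>
    refine ⟨0, zero_mem _, fun r hr => ?_⟩
    obtain ⟨k, hk⟩ := Nat.exists_eq_add_of_lt hr
    rw [hk, Nat.add_assoc, Nat.add_sub_cancel_left, Nat.multichoose_zero_succ, map_zero,
      Nat.cast_zero]
  | succ s ih =>
    induction a with
    | zero =>
      refine ⟨binom j s, Submodule.subset_span ⟨s, s.lt_succ_self, rfl⟩, fun r _ => ?_⟩
      rw [eval_binom, Nat.sub_zero, Nat.multichoose_eq, Nat.add_right_comm,
        Nat.add_sub_cancel, add_comm s, Nat.choose_symm_add]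
    | succ a ih_a =>
      obtain ⟨ψ, hψ, eval_ψ⟩ := ih_a
      obtain ⟨χ, hχ, eval_χ⟩ := ih a
      refine ⟨ψ - χ, sub_mem hψ (Submodule.span_mono (Set.image_mono ?_) hχ), fun r hr => ?_⟩
      · exact Set.Iio_subset_Iio s.le_succ
      · obtain ⟨k, hk⟩ := Nat.exists_eq_add_of_lt hr
        have hpascal := Nat.multichoose_succ_succ s (k + 1)
        rw [map_sub, eval_ψ r (by omega), eval_χ r (by omega), sub_eq_iff_eq_add', hk,
          show a + 1 + k + 1 - a = k + 1 + 1 by omega,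
          show a + 1 + k + 1 - (a + 1) = k + 1 by omega]
        exact_mod_cast hpascal

/-- The product `∏ j, (t_j + k_j choose k_j)`. -/
def binomProd (k : Fin p → ℕ) : MvPolynomial (Fin p) ℚ :=
  ∏ j, binom j (k j)

/-- The integral combinations of the products `∏ j, (t_j + k_j choose k_j)` with `k_j < s_j`. -/
def binomSpan (s : Fin p → ℕ) : Submodule ℤ (MvPolynomial (Fin p) ℚ) :=
  Submodule.span ℤ (binomProd '' {k | ∀ j, k j < s j})

lemma binomSpan_mono : Monotone (binomSpan (p := p)) := fun _ _ h =>
  Submodule.span_mono (Set.image_mono fun _ hk j => (hk j).trans_le (h j))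

lemma prod_mem_binomSpan {s : Fin p → ℕ} {ψ : Fin p → MvPolynomial (Fin p) ℚ}
    (hψ : ∀ j, ψ j ∈ Submodule.span ℤ (binom j '' Set.Iio (s j))) : ∏ j, ψ j ∈ binomSpan s := by
  have hexp : ∀ j, ∃ a : ℕ → ℤ, ∑ k ∈ Iio (s j), a k • binom j k = ψ j := fun j => by
    rw [← Submodule.mem_span_image_finset_iff_exists_fun', coe_Iio]
    exact hψ j
  choose a ha using hexp
  simp only [← ha, prod_univ_sum]
  refine sum_mem fun k hk => ?_
  have hk' : ∀ j, k j < s j := by simpa using hk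
  rw [prod_smul]
  exact Submodule.smul_mem _ _ (Submodule.subset_span ⟨k, hk', rfl⟩)

theorem exists_mem_binomSpan_eval_eq_hilb {ι : Type*} [Fintype ι] (c : ι → Fin p)
    {D : Set (ι → ℕ)} (hD : HasStanleyDecomposition D) :
    ∃ φ ∈ binomSpan fun j => #{v | c v = j},
      ∀ᶠ r : Fin p → ℕ in atTop, eval (fun j => (r j : ℚ)) φ = hilb c D r := by
  induction hD with
  | empty => exact ⟨0, zero_mem _, .of_forall fun r => by simp [hilb]⟩
  | cone a S =>
    choose ψ hψ eval_ψ using fun j =>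
      exists_mem_span_binom_eval_eq_multichoose j #{v ∈ S | c v = j} (multidegree c a j)
    refine ⟨∏ j, ψ j, binomSpan_mono (fun j => card_le_card (filter_subset_filter _ S.subset_univ))
      (prod_mem_binomSpan hψ), ?_⟩
    filter_upwards [eventually_ge_atTop (multidegree c a + 1)] with r hr
    rw [hilb_cone c a S (le_self_add.trans hr), map_prod, Nat.cast_prod]
    exact prod_congr rfl fun j _ => eval_ψ j r (hr j)
  | union _ _ hDE ihD ihE =>
    obtain ⟨φ, hφ, eval_φ⟩ := ihD
    obtain ⟨ψ, hψ, eval_ψ⟩ := ihE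
    refine ⟨φ + ψ, add_mem hφ hψ, ?_⟩
    filter_upwards [eval_φ, eval_ψ] with r hr hr'
    rw [map_add, hr, hr', hilb_union c hDE, Nat.cast_add]

end HilbertPolynomial

section BinomialExpansion

open Finset MvPolynomial

variable {p : ℕ}

lemma degreeOf_binomProd_le (k : Fin p → ℕ) (i : Fin p) : (binomProd k).degreeOf i ≤ k i := by
  have degreeOf_factor : ∀ (j : Fin p) (l : ℕ),
      (X j + C ((l : ℚ) + 1)).degreeOf i ≤ if i = j then 1 else 0 := fun j l => by
    grw [degreeOf_add_le, degreeOf_C, degreeOf_X, max_eq_left (Nat.zero_le _)]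
  have degreeOf_binom : ∀ j, (binom j (k j)).degreeOf i ≤ if i = j then k j else 0 := fun j => by
    rw [binom]
    grw [degreeOf_C_mul_le, degreeOf_prod_le, sum_le_sum fun l _ => degreeOf_factor j l]
    split_ifs <;> simp
  rw [binomProd]
  grw [degreeOf_prod_le, sum_le_sum fun j _ => degreeOf_binom j]
  simp

lemma coeff_binomProd_eq_zero {k : Fin p →₀ ℕ} {l : Fin p → ℕ} (h : ¬ ⇑k ≤ l) :
    coeff k (binomProd l) = 0 := by
  by_contra hne
  exact h fun i =>
    (monomial_le_degreeOf i (mem_support_iff.2 hne)).trans (degreeOf_binomProd_le l i)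

lemma coeff_binomProd_self (k : Fin p →₀ ℕ) :
    coeff k (binomProd k) = ∏ j, ((k j).factorial : ℚ)⁻¹ := by
  let m : MonomialOrder (Fin p) := MonomialOrder.lex
  let Q (j : Fin p) : MvPolynomial (Fin p) ℚ := ∏ l ∈ range (k j), (X j + C ((l : ℚ) + 1))
  have monic_Q : ∀ j, m.Monic (Q j) := fun j => .prod fun l _ => m.monic_X_add_C j _
  have degree_Q : ∀ j, m.degree (Q j) = Finsupp.single j (k j) := fun j => by
    rw [MonomialOrder.degree_prod fun l _ => (m.monic_X_add_C j _).ne_zero,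
      sum_congr rfl fun l _ => m.degree_X_add_C j _]
    simp
  have degree_prod_Q : m.degree (∏ j, Q j) = k := by
    rw [MonomialOrder.degree_prod fun j _ => (monic_Q j).ne_zero,
      sum_congr rfl fun j _ => degree_Q j, Finsupp.univ_sum_single]
  have monic_prod_Q : coeff k (∏ j, Q j) = 1 := by
    rw [← degree_prod_Q]
    exact MonomialOrder.Monic.prod fun j _ => monic_Q j
  rw [binomProd]
  simp only [binom, prod_mul_distrib]
  rw [← map_prod, coeff_C_mul, monic_prod_Q, mul_one]

variable {φ : MvPolynomial (Fin p) ℚ} {a : (Fin p → ℕ) →₀ ℤ}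

lemma coeff_of_linearCombination_binomProd (ha : Finsupp.linearCombination ℤ binomProd a = φ)
    (k : Fin p →₀ ℕ) : coeff k φ = ∑ l ∈ a.support, a l * coeff k (binomProd l) := by
  rw [← ha, Finsupp.linearCombination_apply, Finsupp.sum, coeff_sum]
  exact sum_congr rfl fun l _ => by rw [coeff_smul, zsmul_eq_mul]

lemma coeff_of_forall_gt_eq_zero (ha : Finsupp.linearCombination ℤ binomProd a = φ)
    {k : Fin p →₀ ℕ} (hk : ∀ l, ⇑k < l → a l = 0) :
    coeff k φ = a k * ∏ j, ((k j).factorial : ℚ)⁻¹ := by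
  rw [coeff_of_linearCombination_binomProd ha, sum_eq_single (⇑k), coeff_binomProd_self]
  · intro l hl hne
    rw [coeff_binomProd_eq_zero, mul_zero]
    exact fun hle => Finsupp.mem_support_iff.1 hl (hk l (hle.lt_of_ne hne.symm))
  · intro hk
    rw [Finsupp.notMem_support_iff.1 hk, Int.cast_zero, zero_mul]

lemma exists_ge_mem_support (ha : Finsupp.linearCombination ℤ binomProd a = φ)
    {l : Fin p → ℕ} (hl : l ∈ a.support) : ∃ k ∈ φ.support, l ≤ ⇑k := by
  obtain ⟨k, hlk, hk⟩ := a.support.exists_le_maximal hl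
  let k' : Fin p →₀ ℕ := Finsupp.equivFunOnFinite.symm k
  refine ⟨k', ?_, hlk⟩
  have hgt : ∀ l, ⇑k' < l → a l = 0 := fun l hl =>
    Finsupp.notMem_support_iff.1 fun h => hk.not_gt h hl
  rw [mem_support_iff, coeff_of_forall_gt_eq_zero ha hgt]
  refine mul_ne_zero (Int.cast_ne_zero.2 (Finsupp.mem_support_iff.1 hk.prop))
    (prod_ne_zero_iff.2 fun j _ => inv_ne_zero (Nat.cast_ne_zero.2 (Nat.factorial_ne_zero _)))

lemma exists_mem_support_ge (ha : Finsupp.linearCombination ℤ binomProd a = φ)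
    {k : Fin p →₀ ℕ} (hk : k ∈ φ.support) : ∃ l ∈ a.support, ⇑k ≤ l := by
  by_contra! h
  refine mem_support_iff.1 hk ?_
  rw [coeff_of_linearCombination_binomProd ha]
  exact sum_eq_zero fun l hl => by rw [coeff_binomProd_eq_zero (h l hl), mul_zero]

lemma linearIndependent_binomProd : LinearIndependent ℤ (binomProd (p := p)) := by
  rw [linearIndependent_iff]
  intro a ha
  rw [← Finsupp.support_eq_empty, eq_empty_iff_forall_notMem]
  intro l hl
  obtain ⟨k, hk, -⟩ := exists_ge_mem_support ha hl
  simp at hk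

variable {n : ℕ} {c : Fin n → Fin p}

lemma hasExpansion_iff : HasExpansion c φ a ↔
    (∀ k ∈ a.support, ∀ j, k j ≤ 2 * blockSize c j) ∧
      Finsupp.linearCombination ℤ binomProd a = φ := by
  rw [HasExpansion, Finsupp.linearCombination_apply, eq_comm (a := φ)]
  simp only [Finsupp.sum, binomProd, zsmul_eq_mul, map_intCast]

lemma HasExpansion.linearCombination (h : HasExpansion c φ a) :
    Finsupp.linearCombination ℤ binomProd a = φ :=
  (hasExpansion_iff.1 h).2

lemma HasExpansion.unique {b : (Fin p → ℕ) →₀ ℤ} (ha : HasExpansion c φ a)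
    (hb : HasExpansion c φ b) : a = b :=
  linearIndependent_binomProd (ha.linearCombination.trans hb.linearCombination.symm)

lemma existsUnique_hasExpansion (hφ : φ ∈ binomSpan fun j => 2 * blockSize c j + 1) :
    ∃! a, HasExpansion c φ a := by
  obtain ⟨a, ha, hφ⟩ := (Finsupp.mem_span_image_iff_linearCombination ℤ).1 hφ
  refine existsUnique_of_exists_of_unique ⟨a, hasExpansion_iff.2 ⟨fun k hk j => ?_, hφ⟩⟩
    fun _ _ => HasExpansion.unique
  exact Nat.lt_succ_iff.1 ((Finsupp.mem_supported ℤ a).1 ha hk j)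

end BinomialExpansion

section LeadingForm

open Filter Finset MvPolynomial Topology

variable {σ : Type*} [Finite σ] {w : σ → ℕ} {D : ℕ}

lemma weight_eq_dotProduct {σ : Type*} [Fintype σ] (w : σ → ℕ) (k : σ →₀ ℕ) :
    Finsupp.weight w k = w ⬝ᵥ ⇑k := by
  rw [Finsupp.weight_apply, Finsupp.sum_fintype _ _ (by simp)]
  exact sum_congr rfl fun j _ => mul_comm _ _

lemma tendsto_pow_div_pow {m : ℕ} (hm : m ≤ D) :
    Tendsto (fun N : ℕ => (N : ℚ) ^ m / (N : ℚ) ^ D) atTop (𝓝 (if m = D then 1 else 0)) := by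
  split_ifs with h
  · refine tendsto_const_nhds.congr' ?_
    filter_upwards [eventually_ne_atTop 0] with N hN
    rw [h, div_self (by positivity)]
  · exact (tendsto_pow_div_pow_atTop_zero (hm.lt_of_ne h)).comp tendsto_natCast_atTop_atTop

lemma tendsto_eval_monomial_div (hw : ∀ j, w j ≠ 0) {k : σ →₀ ℕ} (hk : Finsupp.weight w k ≤ D)
    (a : ℚ) (ρ q : σ → ℚ) :
    Tendsto (fun N : ℕ => eval (fun j => ρ j * N ^ w j + q j) (monomial k a) / N ^ D) atTop
      (𝓝 (eval ρ (weightedHomogeneousComponent w D (monomial k a)))) := by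
  cases nonempty_fintype σ
  have limit_eq : eval ρ (weightedHomogeneousComponent w D (monomial k a)) =
      a * (∏ j, ρ j ^ k j) * if Finsupp.weight w k = D then 1 else 0 := by
    have hmon := isWeightedHomogeneous_monomial w k a rfl
    split_ifs with h
    · rw [← h, hmon.weightedHomogeneousComponent_same, eval_monomial,
        Finsupp.prod_fintype _ _ fun _ => pow_zero _, mul_one]
    · rw [hmon.weightedHomogeneousComponent_ne _ (Ne.symm h), map_zero, mul_zero]
  have tendsto_coord : ∀ j, Tendsto (fun N : ℕ => ρ j + q j / (N : ℚ) ^ w j) atTop (𝓝 (ρ j)) := by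
    intro j
    simpa using (tendsto_const_nhds.div_atTop
      ((tendsto_pow_atTop (hw j)).comp tendsto_natCast_atTop_atTop)).const_add (ρ j)
  rw [limit_eq]
  refine (((tendsto_finsetProd _ fun j _ => (tendsto_coord j).pow (k j)).const_mul a).mul
    (tendsto_pow_div_pow hk)).congr' ?_
  filter_upwards [eventually_ne_atTop 0] with N hN
  have prod_eq : ∏ j, (ρ j * (N : ℚ) ^ w j + q j) ^ k j =
      (∏ j, (ρ j + q j / (N : ℚ) ^ w j) ^ k j) * (N : ℚ) ^ Finsupp.weight w k := by
    rw [weight_eq_dotProduct, dotProduct, ← prod_pow_eq_pow_sum, ← prod_mul_distrib]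
    refine prod_congr rfl fun j _ => ?_
    rw [pow_mul, ← mul_pow]
    field_simp
  rw [eval_monomial, Finsupp.prod_fintype _ _ fun _ => pow_zero _, prod_eq]
  ring

lemma tendsto_eval_div (hw : ∀ j, w j ≠ 0) {φ : MvPolynomial σ ℚ}
    (hφ : weightedTotalDegree w φ ≤ D) (ρ q : σ → ℚ) :
    Tendsto (fun N : ℕ => eval (fun j => ρ j * N ^ w j + q j) φ / N ^ D) atTop
      (𝓝 (eval ρ (weightedHomogeneousComponent w D φ))) := by
  have hsum := tendsto_finsetSum φ.support fun k hk =>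
    tendsto_eval_monomial_div hw ((le_weightedTotalDegree w hk).trans hφ) (coeff k φ) ρ q
  simpa only [← sum_div, ← map_sum, support_sum_monomial_coeff] using hsum

lemma eq_of_eventually_eval_eq {σ : Type*} {φ ψ : MvPolynomial σ ℚ}
    (h : ∀ᶠ r : σ → ℕ in atTop, eval (fun j => (r j : ℚ)) φ = eval (fun j => (r j : ℚ)) ψ) :
    φ = ψ := by
  obtain ⟨s, hs⟩ := eventually_atTop.1 h
  refine MvPolynomial.funext_set (fun j => Nat.cast '' Set.Ici (s j))
    (fun j => (Set.Ici_infinite _).image Nat.cast_injective.injOn) fun x hx => ?_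
  choose r hr hx using fun j => hx j (Set.mem_univ j)
  obtain rfl : (fun j => (r j : ℚ)) = x := funext hx
  exact hs r hr

/-- `φ(r) ≤ ψ(r + q)` for some shift `q` and all large `r`. -/
def EventuallyLE (φ ψ : MvPolynomial σ ℚ) : Prop :=
  ∃ q : σ → ℕ, ∀ᶠ r : σ → ℕ in atTop,
    eval (fun j => (r j : ℚ)) φ ≤ eval (fun j => (r j : ℚ) + q j) ψ

variable {φ ψ : MvPolynomial σ ℚ}

lemma EventuallyLE.eval_weightedHomogeneousComponent_le (h : EventuallyLE φ ψ)
    (hw : ∀ j, w j ≠ 0) (hφ : weightedTotalDegree w φ ≤ D) (hψ : weightedTotalDegree w ψ ≤ D)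
    {ρ : σ → ℕ} (hρ : ∀ j, ρ j ≠ 0) :
    eval (fun j => (ρ j : ℚ)) (weightedHomogeneousComponent w D φ) ≤
      eval (fun j => (ρ j : ℚ)) (weightedHomogeneousComponent w D ψ) := by
  cases nonempty_fintype σ
  obtain ⟨q, hq⟩ := h
  refine le_of_tendsto_of_tendsto (tendsto_eval_div hw hφ _ 0)
    (tendsto_eval_div hw hψ _ fun j => (q j : ℚ)) ?_
  have tendsto_ray : Tendsto (fun N : ℕ => fun j => ρ j * N ^ w j) atTop atTop :=
    tendsto_atTop.2 fun s => by
      filter_upwards [eventually_ge_atTop (∑ j, s j)] with N hN j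
      calc s j
        _ ≤ N := (single_le_sum (fun _ _ => Nat.zero_le _) (mem_univ j)).trans hN
        _ ≤ N ^ w j := Nat.le_self_pow (hw j) N
        _ ≤ ρ j * N ^ w j := Nat.le_mul_of_pos_left _ (hρ j).bot_lt
  filter_upwards [tendsto_ray.eventually hq] with N hN
  push_cast at hN
  simp only [Pi.zero_apply, add_zero]
  gcongr

lemma weightedHomogeneousComponent_eq_of_antisymmRel (h : AntisymmRel EventuallyLE φ ψ)
    (hw : ∀ j, w j ≠ 0) (hφ : weightedTotalDegree w φ ≤ D) (hψ : weightedTotalDegree w ψ ≤ D) :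
    weightedHomogeneousComponent w D φ = weightedHomogeneousComponent w D ψ := by
  apply eq_of_eventually_eval_eq
  filter_upwards [eventually_ge_atTop 1] with ρ hρ
  have hρ' : ∀ j, ρ j ≠ 0 := fun j => Nat.one_le_iff_ne_zero.1 (hρ j)
  exact (h.1.eval_weightedHomogeneousComponent_le hw hφ hψ hρ').antisymm
    (h.2.eval_weightedHomogeneousComponent_le hw hψ hφ hρ')

lemma weightedTotalDegree_le_of_antisymmRel (h : AntisymmRel EventuallyLE φ ψ)
    (hw : ∀ j, w j ≠ 0) :
    weightedTotalDegree w φ ≤ weightedTotalDegree w ψ := by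
  by_contra! hlt
  obtain ⟨k, hk, hdeg⟩ := exists_mem_eq_sup φ.support
    (support_nonempty.2 fun h0 => by simp [h0, weightedTotalDegree_zero] at hlt) (Finsupp.weight w)
  have hdeg' : Finsupp.weight w k = weightedTotalDegree w φ := hdeg.symm
  have hcomp := congrArg (coeff k)
    (weightedHomogeneousComponent_eq_of_antisymmRel h hw le_rfl hlt.le)
  rw [weightedHomogeneousComponent_eq_zero _ _ hlt, coeff_weightedHomogeneousComponent,
    if_pos hdeg', coeff_zero] at hcomp
  exact mem_support_iff.1 hk hcomp

lemma weightedTotalDegree_eq_of_antisymmRel (h : AntisymmRel EventuallyLE φ ψ)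
    (hw : ∀ j, w j ≠ 0) :
    weightedTotalDegree w φ = weightedTotalDegree w ψ :=
  (weightedTotalDegree_le_of_antisymmRel h hw).antisymm
    (weightedTotalDegree_le_of_antisymmRel h.symm hw)

lemma coeff_eq_of_weightedTotalDegree_le_weight (h : AntisymmRel EventuallyLE φ ψ)
    (hw : ∀ j, w j ≠ 0) {k : σ →₀ ℕ} (hk : weightedTotalDegree w φ ≤ Finsupp.weight w k) :
    coeff k φ = coeff k ψ := by
  have hcomp := congrArg (coeff k) (weightedHomogeneousComponent_eq_of_antisymmRel h hw hk
    ((weightedTotalDegree_eq_of_antisymmRel h hw).ge.trans hk))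
  rwa [coeff_weightedHomogeneousComponent, coeff_weightedHomogeneousComponent, if_pos rfl,
    if_pos rfl] at hcomp

lemma totalDegree_eq_of_antisymmRel (h : AntisymmRel EventuallyLE φ ψ) :
    φ.totalDegree = ψ.totalDegree := by
  rw [← weightedTotalDegree_one, ← weightedTotalDegree_one]
  exact weightedTotalDegree_eq_of_antisymmRel h fun _ => one_ne_zero

lemma degreeOf_le_of_antisymmRel (h : AntisymmRel EventuallyLE φ ψ) (j : σ) :
    φ.degreeOf j ≤ ψ.degreeOf j := by
  classical
  cases nonempty_fintype σ
  let N := ψ.totalDegree + 1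
  let w : σ → ℕ := 1 + Pi.single j N
  have weight_w : ∀ k : σ →₀ ℕ, Finsupp.weight w k = k.degree + N * k j := fun k => by
    rw [weight_eq_dotProduct, add_dotProduct, one_dotProduct, single_dotProduct,
      Finsupp.degree_eq_sum]
  have weightedTotalDegree_ψ : weightedTotalDegree w ψ < N * (ψ.degreeOf j + 1) := by
    rw [weightedTotalDegree, Finset.sup_lt_iff (by positivity)]
    intro k hk
    have hdeg : k.degree ≤ ψ.totalDegree := le_totalDegree hk
    grw [weight_w, hdeg, monomial_le_degreeOf j hk, mul_add_one, add_comm]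
    exact Nat.add_lt_add_left (Nat.lt_succ_self _) _
  rw [degreeOf_eq_sup]
  refine Finset.sup_le fun k hk => ?_
  have : N * k j < N * (ψ.degreeOf j + 1) := by
    calc N * k j
      _ ≤ Finsupp.weight w k := weight_w k ▸ Nat.le_add_left _ _
      _ ≤ weightedTotalDegree w φ := le_weightedTotalDegree w hk
      _ = weightedTotalDegree w ψ := weightedTotalDegree_eq_of_antisymmRel h fun _ => by simp [w]
      _ < _ := weightedTotalDegree_ψ
  exact Nat.lt_succ_iff.1 (Nat.lt_of_mul_lt_mul_left this)

end LeadingForm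

section Invariants

open Finset MvPolynomial

lemma exists_weight_of_lex {p : ℕ} (S : Finset (Fin p → ℕ)) : ∃ w : Fin p → ℕ, (∀ j, w j ≠ 0) ∧
    ∀ k ∈ S, ∀ l, toLex k < toLex l → w ⬝ᵥ k < w ⬝ᵥ l := by
  induction p with
  | zero =>
    exact ⟨0, nofun, fun k _ l h => absurd h (by rw [Subsingleton.elim k l]; exact lt_irrefl _)⟩
  | succ p ih =>
    obtain ⟨w, hw, hlt⟩ := ih (S.image Fin.tail)
    let N := S.sup (fun k => w ⬝ᵥ Fin.tail k) + 1
    have dotProduct_cons : ∀ k, (Fin.cons N w : Fin (p + 1) → ℕ) ⬝ᵥ k =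
        N * k 0 + w ⬝ᵥ Fin.tail k := fun k => Fin.sum_univ_succ _
    refine ⟨Fin.cons N w, Fin.cases (Nat.succ_ne_zero _) hw, fun k hk l h => ?_⟩
    rw [dotProduct_cons, dotProduct_cons]
    rw [← Fin.cons_self_tail k, ← Fin.cons_self_tail l] at h
    obtain h0 | ⟨h0, htail⟩ := (Fin.pi_lex_lt_cons_cons (α := fun _ => ℕ) (· < ·)).1 h
    · calc N * k 0 + w ⬝ᵥ Fin.tail k
        _ < N * k 0 + N := by
          gcongr
          exact Nat.lt_succ_of_le (le_sup (f := fun k => w ⬝ᵥ Fin.tail k) hk)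
        _ = N * (k 0 + 1) := (mul_add_one _ _).symm
        _ ≤ N * l 0 := Nat.mul_le_mul_left N h0
        _ ≤ N * l 0 + w ⬝ᵥ Fin.tail l := Nat.le_add_right _ _
    · rw [h0]
      exact Nat.add_lt_add_left (hlt _ (mem_image_of_mem _ hk) _ htail) _

variable {p : ℕ} {φ ψ : MvPolynomial (Fin p) ℚ} {a b : (Fin p → ℕ) →₀ ℤ} {w : Fin p → ℕ}

lemma weightedTotalDegree_le_iff (ha : Finsupp.linearCombination ℤ binomProd a = φ) {D : ℕ} :
    weightedTotalDegree w φ ≤ D ↔ ∀ l ∈ a.support, w ⬝ᵥ l ≤ D := by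
  simp only [weightedTotalDegree, Finset.sup_le_iff, weight_eq_dotProduct]
  constructor
  · intro h l hl
    obtain ⟨k, hk, hle⟩ := exists_ge_mem_support ha hl
    exact (dotProduct_le_dotProduct_of_nonneg_left hle zero_le).trans (h k hk)
  · intro h k hk
    obtain ⟨l, hl, hle⟩ := exists_mem_support_ge ha hk
    exact (dotProduct_le_dotProduct_of_nonneg_left hle zero_le).trans (h l hl)

lemma coeff_of_weightedTotalDegree_le (ha : Finsupp.linearCombination ℤ binomProd a = φ)
    (hw : ∀ j, w j ≠ 0) {k : Fin p →₀ ℕ} (hk : weightedTotalDegree w φ ≤ w ⬝ᵥ ⇑k) :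
    coeff k φ = a k * ∏ j, ((k j).factorial : ℚ)⁻¹ := by
  refine coeff_of_forall_gt_eq_zero ha fun l hl => Finsupp.notMem_support_iff.1 fun hmem => ?_
  obtain ⟨hle, j, hj⟩ := Pi.lt_def.1 hl
  have hlt : w ⬝ᵥ ⇑k < w ⬝ᵥ l := sum_lt_sum (fun i _ => Nat.mul_le_mul_left _ (hle i))
    ⟨j, mem_univ j, Nat.mul_lt_mul_of_pos_left hj (hw j).bot_lt⟩
  exact hlt.not_ge ((weightedTotalDegree_le_iff ha).1 hk l hmem)

lemma apply_eq_of_weightedTotalDegree_le (h : AntisymmRel EventuallyLE φ ψ)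
    (ha : Finsupp.linearCombination ℤ binomProd a = φ)
    (hb : Finsupp.linearCombination ℤ binomProd b = ψ) (hw : ∀ j, w j ≠ 0) {k : Fin p → ℕ}
    (hk : weightedTotalDegree w φ ≤ w ⬝ᵥ k) : a k = b k := by
  obtain ⟨k, rfl⟩ := Finsupp.equivFunOnFinite.surjective k
  have hcoeff : coeff k φ = coeff k ψ :=
    coeff_eq_of_weightedTotalDegree_le_weight h hw (by rwa [weight_eq_dotProduct])
  rw [coeff_of_weightedTotalDegree_le ha hw hk, coeff_of_weightedTotalDegree_le hb hw
    ((weightedTotalDegree_eq_of_antisymmRel h hw).ge.trans hk)] at hcoeff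
  have hne : ∏ j, ((k j).factorial : ℚ)⁻¹ ≠ 0 :=
    prod_ne_zero_iff.2 fun j _ => inv_ne_zero (Nat.cast_ne_zero.2 (Nat.factorial_ne_zero _))
  exact_mod_cast mul_right_cancel₀ hne hcoeff

lemma apply_eq_of_totalDegree_le (h : AntisymmRel EventuallyLE φ ψ)
    (ha : Finsupp.linearCombination ℤ binomProd a = φ)
    (hb : Finsupp.linearCombination ℤ binomProd b = ψ) {k : Fin p → ℕ}
    (hk : φ.totalDegree ≤ ∑ j, k j) : a k = b k := by
  refine apply_eq_of_weightedTotalDegree_le h ha hb (w := 1) (fun _ => one_ne_zero) ?_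
  rwa [one_dotProduct, weightedTotalDegree_one]

lemma totalDegree_le_sum_degreeOf (φ : MvPolynomial (Fin p) ℚ) :
    φ.totalDegree ≤ ∑ j, φ.degreeOf j :=
  Finset.sup_le fun k hk => by
    rw [Finsupp.sum_fintype _ _ fun _ => rfl]
    exact sum_le_sum fun j _ => monomial_le_degreeOf j hk

lemma coeff_eq_of_totalDegree_le (h : AntisymmRel EventuallyLE φ ψ) {k : Fin p →₀ ℕ}
    (hk : φ.totalDegree ≤ ∑ j, k j) : coeff k φ = coeff k ψ := by
  refine coeff_eq_of_weightedTotalDegree_le_weight h (w := 1) (fun _ => one_ne_zero) ?_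
  rwa [weight_eq_dotProduct, one_dotProduct, weightedTotalDegree_one]

lemma apply_eq_and_mem_lexMaximal (h : AntisymmRel EventuallyLE φ ψ)
    (ha : Finsupp.linearCombination ℤ binomProd a = φ)
    (hb : Finsupp.linearCombination ℤ binomProd b = ψ) {k : Fin p → ℕ}
    (hk : k ∈ lexMaximal (a.support : Set (Fin p → ℕ))) :
    a k = b k ∧ k ∈ lexMaximal (b.support : Set (Fin p → ℕ)) := by
  obtain ⟨hmem, σ, hmax⟩ := hk
  obtain ⟨w, hw, hlt⟩ := exists_weight_of_lex (a.support.image (· ∘ σ))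
  have dotProduct_perm : ∀ l, (w ∘ σ.symm) ⬝ᵥ l = w ⬝ᵥ (l ∘ σ) := fun l =>
    comp_equiv_symm_dotProduct w l σ
  have hw' : ∀ j, (w ∘ σ.symm) j ≠ 0 := fun j => hw _
  have hφ : weightedTotalDegree (w ∘ σ.symm) φ ≤ (w ∘ σ.symm) ⬝ᵥ k := by
    refine (weightedTotalDegree_le_iff ha).2 fun l hl => ?_
    rw [dotProduct_perm, dotProduct_perm]
    obtain heq | hlex := (hmax l hl).eq_or_lt
    · rw [toLex.injective heq]
    · exact (hlt _ (mem_image_of_mem _ hl) _ hlex).le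
  have hψ := (weightedTotalDegree_eq_of_antisymmRel h hw').ge.trans hφ
  have hab : a k = b k := apply_eq_of_weightedTotalDegree_le h ha hb hw' hφ
  refine ⟨hab, ?_, σ, fun l hl => not_lt.1 fun hlex => ?_⟩
  · rw [mem_coe, Finsupp.mem_support_iff] at hmem ⊢
    rwa [← hab]
  · have hle := (weightedTotalDegree_le_iff hb).1 hψ l hl
    rw [dotProduct_perm, dotProduct_perm] at hle
    exact (hlt _ (mem_image_of_mem _ hmem) _ hlex).not_ge hle

end Invariants

section Level

open Filter Submodule

variable {ι τ J K M : Type*} [Fintype ι] [DecidableEq τ] [Ring K] [AddCommGroup M] [Module K M]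

variable (K) in
/-- The component of degree `r` of the filtration of `span K (Set.range u)`, where `u (i, ξ)` is
thought of as the product of the monomial with exponent `ξ` and a generator `f_i`. -/
def level (u : J × (ι → ℕ) → M) (c : ι → τ) (r : τ → ℕ) : Submodule K M :=
  span K (u '' {t | multidegree c t.2 ≤ r})

variable {u : J × (ι → ℕ) → M} {c : ι → τ}

lemma level_mono : Monotone (level K u c) :=
  fun _ _ hrs => span_mono (Set.image_mono fun _ ht => le_trans ht hrs)

lemma finite_setOf_multidegree_snd_le [Finite J] (c : ι → τ) (r : τ → ℕ) :
    {t : J × (ι → ℕ) | multidegree c t.2 ≤ r}.Finite :=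
  (Set.finite_univ.prod (finite_setOf_multidegree_le c r)).subset fun _ ht => ⟨trivial, ht⟩

instance [Finite J] (r : τ → ℕ) : Module.Finite K (level K u c r) :=
  Module.Finite.span_of_finite K ((finite_setOf_multidegree_snd_le c r).image u)

lemma mem_level {i : J} {ξ : ι → ℕ} {r : τ → ℕ} (hξ : multidegree c ξ ≤ r) :
    u (i, ξ) ∈ level K u c r :=
  subset_span ⟨_, hξ, rfl⟩

lemma eventually_mem_level {y : M} (hy : y ∈ span K (Set.range u)) :
    ∀ᶠ r in atTop, y ∈ level K u c r := by
  induction hy using span_induction with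
  | mem y hy =>
    obtain ⟨⟨i, ξ⟩, rfl⟩ := hy
    exact (eventually_ge_atTop _).mono fun r hr => mem_level hr
  | zero => exact .of_forall fun r => zero_mem _
  | add y z _ _ hy hz => exact hy.mp (hz.mono fun r hz hy => add_mem hy hz)
  | smul k y _ hy => exact hy.mono fun r hy => smul_mem _ k hy

end Level

section MonomialAction

open Filter Submodule

variable {ι τ J J' K M : Type*} [DecidableEq ι] [Ring K] [AddCommGroup M] [Module K M]

lemma exists_eq_add_single {ξ : ι → ℕ} (hξ : ξ ≠ 0) :
    ∃ (η : ι → ℕ) (v : ι), ξ = η + Pi.single v 1 := by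
  obtain ⟨v, hv⟩ := Function.ne_iff.1 hξ
  refine ⟨ξ - Pi.single v 1, v, (tsub_add_cancel_of_le fun w => ?_).symm⟩
  obtain rfl | hw := eq_or_ne w v
  · simpa [Nat.one_le_iff_ne_zero] using hv
  · simp [hw]

lemma lt_add_single (ξ : ι → ℕ) (v : ι) : ξ < ξ + Pi.single v 1 :=
  lt_add_of_pos_right ξ (Pi.single_pos.2 zero_lt_one)

/-- The endomorphisms `g v` act on the family `u` like variables on monomials: `g v` raises the
exponent of the `v`-th variable by one, up to terms with smaller exponents. -/
def IsMonomialAction (g : ι → Module.End K M) (u : J × (ι → ℕ) → M) : Prop :=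
  ∀ v i ξ, g v (u (i, ξ)) - u (i, ξ + Pi.single v 1) ∈ span K (u '' {s | s.1 = i ∧ s.2 ≤ ξ})

variable {g : ι → Module.End K M} {u : J × (ι → ℕ) → M} {u' : J' × (ι → ℕ) → M}

lemma IsMonomialAction.apply_mem_span (hu : IsMonomialAction g u) {v : ι}
    {A B : Set (J × (ι → ℕ))} (hAB : ∀ t ∈ A, ∀ η ≤ t.2 + Pi.single v 1, (t.1, η) ∈ B) {y : M}
    (hy : y ∈ span K (u '' A)) : g v y ∈ span K (u '' B) := by
  refine (span_le.2 ?_ : span K (u '' A) ≤ (span K (u '' B)).comap (g v)) hy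
  rintro _ ⟨⟨i, ξ⟩, ht, rfl⟩
  have top_mem : u (i, ξ + Pi.single v 1) ∈ span K (u '' B) :=
    subset_span ⟨_, hAB _ ht _ le_rfl, rfl⟩
  have lower_mem : g v (u (i, ξ)) - u (i, ξ + Pi.single v 1) ∈ span K (u '' B) := by
    refine span_mono (Set.image_mono ?_) (hu v i ξ)
    rintro ⟨_, η⟩ ⟨rfl, hη⟩
    exact hAB _ ht _ (hη.trans (lt_add_single ξ v).le)
  exact (sub_mem_iff_left _ top_mem).1 lower_mem

variable [Fintype ι] [DecidableEq τ] {c : ι → τ}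

lemma multidegree_add_single (c : ι → τ) (ξ : ι → ℕ) (v : ι) :
    multidegree c (ξ + Pi.single v 1) = multidegree c ξ + Pi.single (c v) 1 := by
  ext j
  simp [multidegree_apply, Finset.sum_add_distrib, Pi.single_apply, eq_comm]

lemma IsMonomialAction.apply_mem_level (hu : IsMonomialAction g u) (v : ι) {r : τ → ℕ} {y : M}
    (hy : y ∈ level K u c r) : g v y ∈ level K u c (r + Pi.single (c v) 1) := by
  refine hu.apply_mem_span (fun t ht η hη => (multidegree_mono c hη).trans ?_) hy
  rw [multidegree_add_single]
  exact add_le_add_left ht _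

lemma exists_level_le_level_add [Finite J'] (c : ι → τ) (hu : IsMonomialAction g u)
    (hu' : IsMonomialAction g u') (h : ∀ i, u' (i, 0) ∈ span K (Set.range u)) :
    ∃ s, ∀ r, level K u' c r ≤ level K u c (r + s) := by
  obtain ⟨s, hs⟩ := (eventually_all.2 fun i => eventually_mem_level (c := c) (h i)).exists
  suffices vector_mem : ∀ ξ i, u' (i, ξ) ∈ level K u c (multidegree c ξ + s) by
    refine ⟨s, fun r => span_le.2 ?_⟩
    rintro _ ⟨⟨i, ξ⟩, hξ, rfl⟩
    exact level_mono (add_le_add_left hξ s) (vector_mem ξ i)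
  intro ξ
  induction ξ using WellFoundedLT.induction with | ind ξ ih
  intro i
  obtain rfl | hξ := eq_or_ne ξ 0
  · simpa using hs i
  obtain ⟨η, v, rfl⟩ := exists_eq_add_single hξ
  have image_mem : g v (u' (i, η)) ∈ level K u c (multidegree c (η + Pi.single v 1) + s) := by
    rw [multidegree_add_single, add_right_comm]
    exact hu.apply_mem_level v (ih η (lt_add_single η v) i)
  have lower_mem : g v (u' (i, η)) - u' (i, η + Pi.single v 1) ∈
      level K u c (multidegree c (η + Pi.single v 1) + s) := by
    refine span_le.2 ?_ (hu' v i η)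
    rintro _ ⟨⟨j, ζ⟩, ⟨-, hζ⟩, rfl⟩
    have hlt := hζ.trans_lt (lt_add_single η v)
    exact level_mono (add_le_add_left (multidegree_mono c hlt.le) s) (ih ζ hlt j)
  exact (sub_mem_iff_right _ image_mem).1 lower_mem

end MonomialAction

section LeadingMonomials

open Filter Finset MvPolynomial

lemma finrank_sup_span_singleton {K M : Type*} [DivisionRing K] [AddCommGroup M] [Module K M]
    {p : Submodule K M} [FiniteDimensional K p] {y : M} (hy : y ∉ p) :
    Module.finrank K (p ⊔ Submodule.span K {y} : Submodule K M) = Module.finrank K p + 1 := by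
  have hsum := Submodule.finrank_sup_add_finrank_inf_eq p (Submodule.span K {y})
  rwa [(Submodule.disjoint_span_singleton_of_notMem hy).eq_bot, finrank_bot, add_zero,
    finrank_span_singleton (ne_of_mem_of_not_mem p.zero_mem hy).symm] at hsum

lemma finrank_span_image_eq_ncard {K M T L : Type*} [DivisionRing K] [AddCommGroup M] [Module K M]
    [LinearOrder L] (u : T → M) {key : T → L} (hkey : Function.Injective key) (S : Finset T) :
    Module.finrank K (Submodule.span K (u '' (S : Set T))) =
      {t | t ∈ S ∧ u t ∉ Submodule.span K (u '' {s | s ∈ S ∧ key s < key t})}.ncard := by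
  classical
  induction S using Finset.induction_on_max_value key with
  | empty =>
    rw [coe_empty, Set.image_empty, Submodule.span_empty, finrank_bot]
    simp
  | insert a S ha hmax ih =>
    have hlt : ∀ s ∈ S, key s < key a := fun s hs =>
      (hmax s hs).lt_of_ne fun h => ha (hkey h ▸ hs)
    have below_a : {s | (s = a ∨ s ∈ S) ∧ key s < key a} = (S : Set T) := by
      ext s
      grind
    have below : ∀ t ∈ S, {s | (s = a ∨ s ∈ S) ∧ key s < key t} = {s | s ∈ S ∧ key s < key t} := by
      intro t ht
      ext s
      grind
    have : FiniteDimensional K (Submodule.span K (u '' (S : Set T))) :=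
      .span_of_finite K (S.finite_toSet.image u)
    rw [coe_insert, Set.image_insert_eq]
    by_cases hmem : u a ∈ Submodule.span K (u '' (S : Set T))
    · rw [Submodule.span_insert_eq_span hmem, ih]
      congr 1
      ext t
      obtain rfl | hta := eq_or_ne t a
      · simp [below_a, ha, hmem]
      · simp +contextual [hta, below]
    · rw [Submodule.span_insert, sup_comm, finrank_sup_span_singleton hmem, ih,
        ← Set.ncard_insert_of_notMem (a := a) (by simp [ha])
          (S.finite_toSet.subset fun t ht => ht.1)]
      congr 1
      ext t
      obtain rfl | hta := eq_or_ne t a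
      · simp [below_a, hmem]
      · simp +contextual [hta, below]

lemma isLowerSet_of_add_single_mem {ι : Type*} [Finite ι] [DecidableEq ι] {D : Set (ι → ℕ)}
    (hD : ∀ ξ v, ξ + Pi.single v 1 ∈ D → ξ ∈ D) : IsLowerSet D := by
  intro ξ η hle hξ
  obtain ⟨δ, rfl⟩ := exists_add_of_le hle
  clear hle
  induction δ using WellFoundedLT.induction with | ind δ ih
  obtain rfl | hδ := eq_or_ne δ 0
  · simpa using hξ
  obtain ⟨ζ, v, rfl⟩ := exists_eq_add_single hδ
  exact ih ζ (lt_add_single ζ v) (hD _ v (by rwa [add_assoc]))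

variable {ι τ J K M : Type*} [Fintype ι]

section IndexKey

/-- The sort key of the monomial order with which leading terms are taken: generators are compared
first, exponents lexicographically, for an arbitrary enumeration of the variables. -/
def indexKey (t : J × (ι → ℕ)) : J ×ₗ Lex (Fin (Fintype.card ι) → ℕ) :=
  toLex (t.1, toLex (t.2 ∘ (Fintype.equivFin ι).symm))

lemma indexKey_injective : Function.Injective (indexKey (ι := ι) (J := J)) := by
  rintro ⟨i, ξ⟩ ⟨j, η⟩ h
  obtain ⟨hij, hξη⟩ := Prod.ext_iff.1 (toLex.injective h)
  exact Prod.ext hij ((Fintype.equivFin ι).symm.surjective.injective_comp_right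
    (toLex.injective hξη))

variable [LinearOrder J]

lemma indexKey_strictMono (i : J) : StrictMono fun ξ : ι → ℕ => indexKey (i, ξ) :=
  Monotone.strictMono_of_injective
    (fun _ _ h => Prod.Lex.toLex_mono ⟨le_rfl, Pi.toLex_monotone fun _ => h _⟩)
    (indexKey_injective.comp (Prod.mk_right_injective i))

lemma indexKey_add_lt_add {i j : J} {ξ η : ι → ℕ} (h : indexKey (i, ξ) < indexKey (j, η))
    (δ : ι → ℕ) : indexKey (i, ξ + δ) < indexKey (j, η + δ) := by
  rw [indexKey, indexKey, Prod.Lex.toLex_lt_toLex] at h ⊢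
  exact h.imp_right fun ⟨hij, hlt⟩ => ⟨hij, add_lt_add_left hlt (toLex (δ ∘ _))⟩

end IndexKey

variable [DecidableEq τ] [LinearOrder J]

section Reducible

variable [Ring K] [AddCommGroup M] [Module K M]

variable (K) in
/-- The vector with index `t` is a combination of smaller ones of multidegree at most `r`. -/
def Reducible (u : J × (ι → ℕ) → M) (c : ι → τ) (r : τ → ℕ) (t : J × (ι → ℕ)) : Prop :=
  u t ∈ Submodule.span K (u '' {s | multidegree c s.2 ≤ r ∧ indexKey s < indexKey t})

variable {u : J × (ι → ℕ) → M} {c : ι → τ}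

lemma Reducible.mono {r r' : τ → ℕ} (hr : r ≤ r') {t : J × (ι → ℕ)} (h : Reducible K u c r t) :
    Reducible K u c r' t :=
  Submodule.span_mono (Set.image_mono fun _ (hs : _ ∧ _) => And.intro (hs.1.trans hr) hs.2) h

lemma Reducible.add_single [DecidableEq ι] {g : ι → Module.End K M} (hu : IsMonomialAction g u)
    {r : τ → ℕ} {i : J} {ξ : ι → ℕ} (hξ : multidegree c ξ ≤ r) (h : Reducible K u c r (i, ξ))
    (v : ι) : Reducible K u c (r + Pi.single (c v) 1) (i, ξ + Pi.single v 1) := by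
  have image_mem : g v (u (i, ξ)) ∈ Submodule.span K (u '' {s | multidegree c s.2 ≤
      r + Pi.single (c v) 1 ∧ indexKey s < indexKey (i, ξ + Pi.single v 1)}) := by
    refine hu.apply_mem_span ?_ h
    rintro ⟨j, ζ⟩ ⟨hζ, hlt⟩ η hη
    refine ⟨(multidegree_mono c hη).trans ?_, ((indexKey_strictMono j).monotone hη).trans_lt
      (indexKey_add_lt_add hlt _)⟩
    rw [multidegree_add_single]
    exact add_le_add_left hζ _
  refine (Submodule.sub_mem_iff_right _ image_mem).1
    (Submodule.span_mono (Set.image_mono ?_) (hu v i ξ))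
  rintro ⟨_, η⟩ ⟨rfl, hη⟩
  exact ⟨((multidegree_mono c hη).trans hξ).trans le_self_add,
    indexKey_strictMono _ (hη.trans_lt (lt_add_single ξ v))⟩

variable [Fintype τ]

variable (K u c) in
/-- The exponents `ζ` for which the vector with index `(i, ζ ∘ Sum.inl)` is irreducible in
multidegree `multidegree ζ`. The extra variables `Sum.inr j` are homogenizing ones: they turn the
count of irreducible vectors of multidegree at most `r` into a Hilbert function at `r`. -/
def irreducibleSet (i : J) : Set (ι ⊕ τ → ℕ) :=
  {ζ | ¬ Reducible K u c (multidegree (Sum.elim c id) ζ) (i, ζ ∘ Sum.inl)}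

end Reducible

variable [Fintype τ]

lemma multidegree_sumElim_id (c : ι → τ) (ζ : ι ⊕ τ → ℕ) :
    multidegree (Sum.elim c id) ζ = multidegree c (ζ ∘ Sum.inl) + ζ ∘ Sum.inr := by
  ext j
  simp only [Pi.add_apply, multidegree_apply, sum_filter, Fintype.sum_sum_type]
  exact congrArg _ (Fintype.sum_ite_eq' j (ζ ∘ Sum.inr))

lemma isLowerSet_irreducibleSet [Ring K] [AddCommGroup M] [Module K M] [DecidableEq ι]
    {g : ι → Module.End K M} {u : J × (ι → ℕ) → M} (hu : IsMonomialAction g u) (c : ι → τ) (i : J) :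
    IsLowerSet (irreducibleSet K u c i) := by
  refine isLowerSet_of_add_single_mem fun ζ v hζ hred => hζ ?_
  rw [multidegree_add_single]
  cases v with
  | inl v =>
    have hinl : (ζ + Pi.single (Sum.inl v) 1) ∘ Sum.inl = ζ ∘ Sum.inl + Pi.single v 1 := by
      ext w
      simp [Pi.single_apply]
    rw [hinl]
    refine hred.add_single hu ?_ v
    rw [multidegree_sumElim_id]
    exact le_self_add
  | inr j =>
    have hinl : (ζ + Pi.single (Sum.inr j) 1) ∘ Sum.inl = ζ ∘ Sum.inl := by
      ext w
      simp
    rw [hinl]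
    exact hred.mono le_self_add

lemma hilb_irreducibleSet [Ring K] [AddCommGroup M] [Module K M] (u : J × (ι → ℕ) → M) (c : ι → τ)
    (i : J) (r : τ → ℕ) :
    hilb (Sum.elim c id) (irreducibleSet K u c i) r =
      {ξ | multidegree c ξ ≤ r ∧ ¬ Reducible K u c r (i, ξ)}.ncard := by
  have hinj : Function.Injective fun ξ : ι → ℕ => Sum.elim ξ (r - multidegree c ξ) :=
    Function.LeftInverse.injective (g := fun ζ => ζ ∘ Sum.inl) fun ξ => Sum.elim_comp_inl ξ _
  rw [hilb, ← Set.ncard_image_of_injective _ hinj]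
  congr 1
  ext ζ
  constructor
  · rintro ⟨hζ, rfl⟩
    refine ⟨ζ ∘ Sum.inl, ⟨?_, hζ⟩, ?_⟩
    · rw [multidegree_sumElim_id]
      exact le_self_add
    · dsimp only
      rw [multidegree_sumElim_id, add_tsub_cancel_left, Sum.elim_comp_inl_inr]
  · rintro ⟨ξ, ⟨hξ, hred⟩, rfl⟩
    have hdeg : multidegree (Sum.elim c id) (Sum.elim ξ (r - multidegree c ξ)) = r := by
      rw [multidegree_sumElim_id, Sum.elim_comp_inl, Sum.elim_comp_inr, add_tsub_cancel_of_le hξ]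
    exact ⟨by rwa [irreducibleSet, Set.mem_ofPred_eq, hdeg], hdeg⟩

variable [Fintype J] [DivisionRing K] [AddCommGroup M] [Module K M]

lemma finrank_level (u : J × (ι → ℕ) → M) (c : ι → τ) (r : τ → ℕ) :
    Module.finrank K (level K u c r) =
      ∑ i, hilb (Sum.elim c id) (irreducibleSet K u c i) r := by
  have hfin := finite_setOf_multidegree_snd_le (J := J) c r
  have irreducible_eq : {t : J × (ι → ℕ) | multidegree c t.2 ≤ r ∧ ¬ Reducible K u c r t} =
      ⋃ i, Prod.mk i '' {ξ | multidegree c ξ ≤ r ∧ ¬ Reducible K u c r (i, ξ)} := by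
    ext ⟨i, ξ⟩
    simp
  have hdisj : Pairwise (Function.onFun Disjoint fun i =>
      Prod.mk i '' {ξ | multidegree c ξ ≤ r ∧ ¬ Reducible K u c r (i, ξ)}) := by
    intro i j hij
    rw [Function.onFun, Set.disjoint_left]
    rintro _ ⟨ξ, -, rfl⟩ ⟨η, -, he⟩
    exact hij (Prod.ext_iff.1 he).1.symm
  have hrank := finrank_span_image_eq_ncard (K := K) u indexKey_injective hfin.toFinset
  rw [hfin.coe_toFinset] at hrank
  simp only [hfin.mem_toFinset, Set.mem_ofPred_eq] at hrank
  refine hrank.trans ?_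
  change {t | multidegree c t.2 ≤ r ∧ ¬ Reducible K u c r t}.ncard = _
  rw [irreducible_eq, Set.ncard_iUnion_of_finite
    (fun i => ((finite_setOf_multidegree_le c r).subset fun _ h => h.1).image _) hdisj,
    finsum_eq_sum_of_fintype]
  refine sum_congr rfl fun i _ => ?_
  rw [Set.ncard_image_of_injective _ (Prod.mk_right_injective i), hilb_irreducibleSet]

end LeadingMonomials

section DimensionOfLevels

open Filter Finset MvPolynomial

variable {ι J J' K M : Type*} [Fintype ι] [DecidableEq ι] [DivisionRing K] [AddCommGroup M]
  [Module K M] {p : ℕ} {g : ι → Module.End K M} {u : J × (ι → ℕ) → M} {u' : J' × (ι → ℕ) → M}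

theorem exists_mem_binomSpan_eval_eq_finrank_level [LinearOrder J] [Finite J]
    (hu : IsMonomialAction g u) (c : ι → Fin p) :
    ∃ φ ∈ binomSpan fun j => #{v | c v = j} + 1,
      ∀ᶠ r : Fin p → ℕ in atTop,
        eval (fun j => (r j : ℚ)) φ = Module.finrank K (level K u c r) := by
  cases nonempty_fintype J
  have hcard : ∀ j, #{v | Sum.elim c id v = j} = #{v | c v = j} + 1 := fun j => by
    simp only [card_filter, Fintype.sum_sum_type]
    exact congrArg _ (Fintype.sum_ite_eq' j fun _ => 1)
  choose φ hφ eval_φ using fun i => exists_mem_binomSpan_eval_eq_hilb (Sum.elim c id)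
    (hasStanleyDecomposition_of_isLowerSet (isLowerSet_irreducibleSet hu c i))
  simp only [hcard] at hφ
  refine ⟨∑ i, φ i, sum_mem fun i _ => hφ i, ?_⟩
  filter_upwards [eventually_all.2 eval_φ] with r hr
  rw [map_sum, finrank_level, Nat.cast_sum]
  exact sum_congr rfl fun i _ => hr i

lemma eventuallyLE_of_eval_eq_finrank_level [Finite J] [Finite J'] {σ : Type*} [Finite σ]
    [DecidableEq σ] {c : ι → σ} (hu : IsMonomialAction g u) (hu' : IsMonomialAction g u')
    (h : ∀ i, u (i, 0) ∈ Submodule.span K (Set.range u')) {φ φ' : MvPolynomial σ ℚ}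
    (hφ : ∀ᶠ r : σ → ℕ in atTop, eval (fun j => (r j : ℚ)) φ = Module.finrank K (level K u c r))
    (hφ' : ∀ᶠ r : σ → ℕ in atTop,
      eval (fun j => (r j : ℚ)) φ' = Module.finrank K (level K u' c r)) :
    EventuallyLE φ φ' := by
  obtain ⟨s, hs⟩ := exists_level_le_level_add c hu' hu h
  refine ⟨s, ?_⟩
  have tendsto_add : Tendsto (· + s) atTop atTop :=
    tendsto_atTop_mono (fun _ => le_self_add) tendsto_id
  filter_upwards [hφ, tendsto_add.eventually hφ'] with r hr hr'
  simp only [Pi.add_apply, Nat.cast_add] at hr'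
  rw [hr, hr']
  exact_mod_cast Submodule.finrank_mono (hs r)

end DimensionOfLevels

section OrderedProducts

variable {A : Type*} [Semiring A] {n : ℕ}

lemma mul_prod_ofFn_pow {g : Fin n → A} (hg : ∀ i j, Commute (g i) (g j)) (α : Fin n → ℕ)
    (i : Fin n) :
    g i * (List.ofFn fun j => g j ^ α j).prod =
      (List.ofFn fun j => g j ^ (α + Pi.single i 1 : Fin n → ℕ) j).prod := by
  induction n with
  | zero => exact i.elim0
  | succ n ih =>
    simp only [List.ofFn_succ, List.prod_cons]
    cases i using Fin.cases with
    | zero => simp [← mul_assoc, pow_succ']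
    | succ i =>
      have htail := ih (g := fun j => g j.succ) (fun _ _ => hg _ _) (fun j => α j.succ) i
      rw [← mul_assoc, ((hg i.succ 0).pow_right (α 0)).eq, mul_assoc, htail]
      simp [Pi.single_apply, Fin.succ_inj, (Fin.succ_ne_zero i).symm]

lemma mul_pow_of_mul_eq_add_one {D g : A} (h : D * g = g * D + 1) (a : ℕ) :
    D * g ^ a = g ^ a * D + a • g ^ (a - 1) := by
  induction a with
  | zero => simp
  | succ a ih =>
    have hlast : (a • g ^ (a - 1)) * g = a • g ^ a := by
      cases a with
      | zero => simp
      | succ a => rw [Nat.add_sub_cancel, smul_mul_assoc, ← pow_succ]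
    calc D * g ^ (a + 1) = (D * g ^ a) * g := by rw [pow_succ, mul_assoc]
      _ = g ^ a * (D * g) + a • g ^ a := by rw [ih, add_mul, hlast, mul_assoc]
      _ = g ^ (a + 1) * D + (a + 1) • g ^ a := by
        rw [h, mul_add, ← mul_assoc, ← pow_succ, mul_one, add_assoc, succ_nsmul']

lemma mul_prod_ofFn_pow_of_mul_eq_add_one {g : Fin n → A} {D : A} {i : Fin n}
    (hD : ∀ j, i ≠ j → Commute D (g j)) (hi : D * g i = g i * D + 1) (α : Fin n → ℕ) :
    D * (List.ofFn fun j => g j ^ α j).prod = (List.ofFn fun j => g j ^ α j).prod * D +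
      α i • (List.ofFn fun j => g j ^ (α - Pi.single i 1 : Fin n → ℕ) j).prod := by
  induction n with
  | zero => exact i.elim0
  | succ n ih =>
    simp only [List.ofFn_succ, List.prod_cons]
    cases i using Fin.cases with
    | zero =>
      have htail : Commute D (List.ofFn fun j : Fin n => g j.succ ^ α j.succ).prod :=
        Commute.list_prod_right _ _ ((List.forall_mem_ofFn_iff).2 fun j =>
          (hD _ (Fin.succ_ne_zero j).symm).pow_right _)
      rw [← mul_assoc, mul_pow_of_mul_eq_add_one hi, add_mul, mul_assoc, htail.eq, ← mul_assoc,
        smul_mul_assoc]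
      simp
    | succ i =>
      have htail := ih (g := fun j => g j.succ) (fun j hj => hD _ (by simpa using hj)) hi
        (fun j => α j.succ)
      rw [← mul_assoc, ((hD 0 (Fin.succ_ne_zero i)).pow_right (α 0)).eq, mul_assoc, htail,
        mul_add, ← mul_assoc, mul_smul_comm]
      simp [Pi.single_apply, Fin.succ_inj, (Fin.succ_ne_zero i).symm]

end OrderedProducts

section WeylAlgebra

variable {K : Type*} [Field K] {n : ℕ}

lemma commute_x (i j : Fin n) : Commute (x K i) (x K j) := by
  simpa [x, commute_iff_eq] using RingQuot.mkAlgHom_rel K (Rel.x_comm (K := K) i j)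

lemma commute_d (i j : Fin n) : Commute (d K i) (d K j) := by
  simpa [d, commute_iff_eq] using RingQuot.mkAlgHom_rel K (Rel.d_comm (K := K) i j)

lemma commute_d_x {i j : Fin n} (h : i ≠ j) : Commute (d K i) (x K j) := by
  simpa [x, d, commute_iff_eq] using
    RingQuot.mkAlgHom_rel K (Rel.d_x_of_ne (K := K) i j h)

lemma d_mul_x (i : Fin n) : d K i * x K i = x K i * d K i + 1 := by
  simpa [x, d] using RingQuot.mkAlgHom_rel K (Rel.d_x (K := K) i)

lemma x_mul_mono (i : Fin n) (α β : Fin n → ℕ) :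
    x K i * mono K α β = mono K (α + Pi.single i 1) β := by
  rw [mono, ← mul_assoc, mul_prod_ofFn_pow commute_x, mono]

lemma d_mul_mono (i : Fin n) (α β : Fin n → ℕ) :
    d K i * mono K α β = mono K α (β + Pi.single i 1) + α i • mono K (α - Pi.single i 1) β := by
  rw [mono, ← mul_assoc,
    mul_prod_ofFn_pow_of_mul_eq_add_one (fun j hj => commute_d_x hj) (d_mul_x i), add_mul,
    mul_assoc, mul_prod_ofFn_pow commute_d, smul_mul_assoc, mono, mono]

end WeylAlgebra

section Filtration

open Filter Finset MvPolynomial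

variable (K : Type*) [Field K] (n : ℕ) {p m q : ℕ} {M : Type*} [AddCommGroup M]
  [Module (WeylAlgebra K n) M]

/-- The element `x^α ∂^β f_i`; the exponents `α` and `β` are joined into one function. -/
def monoSMul (f : Fin m → M) (t : Fin m × (Fin n ⊕ Fin n → ℕ)) : M :=
  mono K (t.2 ∘ Sum.inl) (t.2 ∘ Sum.inr) • f t.1

lemma monoSMul_zero (f : Fin m → M) (i : Fin m) : monoSMul K n f (i, 0) = f i := by
  simp [monoSMul, mono]

variable [Module K M] [IsScalarTower K (WeylAlgebra K n) M]

variable (M) in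
/-- The action of the generators `x i` and `∂ i` of the Weyl algebra on a module. -/
def genAction (v : Fin n ⊕ Fin n) : Module.End K M :=
  Algebra.lsmul K K M (Sum.elim (x K) (d K) v)

variable {K n}

lemma isMonomialAction_genAction (f : Fin m → M) :
    IsMonomialAction (genAction K n M) (monoSMul K n f) := by
  rintro (v | v) i ξ
  · have hx : genAction K n M (Sum.inl v) (monoSMul K n f (i, ξ)) =
        monoSMul K n f (i, ξ + Pi.single (Sum.inl v) 1) := by
      simp only [genAction, monoSMul, Sum.elim_inl, Algebra.lsmul_coe, smul_smul, x_mul_mono]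
      congr 2
      ext w
      simp [Pi.single_apply]
    rw [hx, sub_self]
    exact zero_mem _
  · have hd : genAction K n M (Sum.inr v) (monoSMul K n f (i, ξ)) =
        monoSMul K n f (i, ξ + Pi.single (Sum.inr v) 1) +
          ξ (Sum.inl v) • monoSMul K n f (i, ξ - Pi.single (Sum.inl v) 1) := by
      simp only [genAction, monoSMul, Sum.elim_inr, Algebra.lsmul_coe, smul_smul, d_mul_mono,
        add_smul, smul_assoc]
      congr 1
      · congr 2
        ext w
        simp [Pi.single_apply]
      · congr 3
        ext w
        simp [Pi.single_apply]
    rw [hd, add_sub_cancel_left]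
    refine nsmul_mem (Submodule.subset_span ?_) _
    exact ⟨_, ⟨rfl, tsub_le_self⟩, rfl⟩

lemma smul_mem_span_range_monoSMul {f : Fin m → M} (a : WeylAlgebra K n) {y : M}
    (hy : y ∈ Submodule.span K (Set.range (monoSMul K n f))) :
    a • y ∈ Submodule.span K (Set.range (monoSMul K n f)) := by
  obtain ⟨b, rfl⟩ := RingQuot.mkAlgHom_surjective K (Rel K n) a
  induction b using FreeAlgebra.induction generalizing y with
  | grade0 k =>
    rw [AlgHom.commutes, algebraMap_smul]
    exact Submodule.smul_mem _ k hy
  | grade1 v =>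
    have hv : RingQuot.mkAlgHom K (Rel K n) (FreeAlgebra.ι K v) • y = genAction K n M v y := by
      cases v <;> rfl
    rw [← Set.image_univ] at hy ⊢
    rw [hv]
    exact (isMonomialAction_genAction f).apply_mem_span (fun _ _ _ _ => Set.mem_univ _) hy
  | mul b b' hb hb' =>
    rw [map_mul, mul_smul]
    exact hb (hb' hy)
  | add b b' hb hb' =>
    rw [map_add, add_smul]
    exact add_mem (hb hy) (hb' hy)

lemma mem_span_range_monoSMul {f : Fin m → M} {y : M}
    (hy : y ∈ Submodule.span (WeylAlgebra K n) (Set.range f)) :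
    y ∈ Submodule.span K (Set.range (monoSMul K n f)) := by
  induction hy using Submodule.span_induction with
  | mem y hy =>
    obtain ⟨i, rfl⟩ := hy
    exact Submodule.subset_span ⟨(i, 0), monoSMul_zero K n f i⟩
  | zero => exact zero_mem _
  | add y z _ _ hy hz => exact add_mem hy hz
  | smul a y _ hy => exact smul_mem_span_range_monoSMul a hy

variable {c : Fin n → Fin p}

lemma multidegree_sumElim_self (c : Fin n → Fin p) (ξ : Fin n ⊕ Fin n → ℕ) (j : Fin p) :
    multidegree (Sum.elim c c) ξ j = ordMono c j (ξ ∘ Sum.inl) (ξ ∘ Sum.inr) := by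
  simp only [multidegree_apply, ordMono, sum_filter, Fintype.sum_sum_type, sum_add_distrib]
  rfl

lemma filt_eq_level (f : Fin m → M) (r : Fin p → ℕ) :
    filt K c f (fun j => (r j : ℤ)) = level K (monoSMul K n f) (Sum.elim c c) r := by
  have hmono : {D | ∃ α β : Fin n → ℕ, (∀ j, (ordMono c j α β : ℤ) ≤ r j) ∧ D = mono K α β} =
      (fun ξ => mono K (ξ ∘ Sum.inl) (ξ ∘ Sum.inr)) '' {ξ | multidegree (Sum.elim c c) ξ ≤ r} := by
    ext D
    constructor
    · rintro ⟨α, β, h, rfl⟩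
      refine ⟨Sum.elim α β, fun j => ?_, rfl⟩
      rw [multidegree_sumElim_self]
      exact_mod_cast h j
    · rintro ⟨ξ, h, rfl⟩
      refine ⟨_, _, fun j => ?_, rfl⟩
      rw [← multidegree_sumElim_self]
      exact_mod_cast h j
  simp only [filt, W, hmono, level, Submodule.map_span, ← Submodule.span_iUnion]
  congr 1
  ext y
  simp [monoSMul]

lemma isDimensionPolynomial_iff {f : Fin m → M} {φ : MvPolynomial (Fin p) ℚ} :
    IsDimensionPolynomial K c f φ ↔ ∀ᶠ r : Fin p → ℕ in atTop,
      eval (fun j => (r j : ℚ)) φ =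
        Module.finrank K (level K (monoSMul K n f) (Sum.elim c c) r) := by
  simp only [eventually_atTop]
  constructor
  · rintro ⟨s, hs⟩
    refine ⟨fun j => (s j).toNat, fun r hr => ?_⟩
    rw [← filt_eq_level]
    simpa using hs (fun j => (r j : ℤ)) fun j => Int.toNat_le.1 (hr j)
  · rintro ⟨s, hs⟩
    refine ⟨fun j => (s j : ℤ), fun r hr => ?_⟩
    lift r to Fin p → ℕ using fun j => (Int.natCast_nonneg _).trans (hr j)
    rw [filt_eq_level]
    simpa using hs r fun j => Int.ofNat_le.1 (hr j)

lemma card_filter_sumElim_self (c : Fin n → Fin p) (j : Fin p) :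
    #{v | Sum.elim c c v = j} = 2 * blockSize c j := by
  simp only [card_filter, Fintype.sum_sum_type, blockSize, two_mul]
  rfl

lemma exists_mem_binomSpan_isDimensionPolynomial (c : Fin n → Fin p) (f : Fin m → M) :
    ∃ φ ∈ binomSpan fun j => 2 * blockSize c j + 1, IsDimensionPolynomial K c f φ := by
  simpa only [isDimensionPolynomial_iff, card_filter_sumElim_self] using
    exists_mem_binomSpan_eval_eq_finrank_level (isMonomialAction_genAction f) (Sum.elim c c)

variable {f : Fin m → M} {φ φ' : MvPolynomial (Fin p) ℚ}

lemma IsDimensionPolynomial.unique (hφ : IsDimensionPolynomial K c f φ)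
    (hφ' : IsDimensionPolynomial K c f φ') : φ = φ' := by
  rw [isDimensionPolynomial_iff] at hφ hφ'
  refine eq_of_eventually_eval_eq ?_
  filter_upwards [hφ, hφ'] with r hr hr'
  rw [hr, hr']

variable (c f) in
lemma existsUnique_isDimensionPolynomial : ∃! φ, IsDimensionPolynomial K c f φ :=
  let ⟨φ, _, hφ⟩ := exists_mem_binomSpan_isDimensionPolynomial c f
  ⟨φ, hφ, fun _ hφ' => hφ'.unique hφ⟩

lemma IsDimensionPolynomial.mem_binomSpan (hφ : IsDimensionPolynomial K c f φ) :
    φ ∈ binomSpan fun j => 2 * blockSize c j + 1 := by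
  obtain ⟨ψ, hψ, hfψ⟩ :=
    exists_mem_binomSpan_isDimensionPolynomial (K := K) c f
  rwa [hφ.unique hfψ]

lemma IsDimensionPolynomial.eventuallyLE {h : Fin q → M} (hφ : IsDimensionPolynomial K c f φ)
    (hφ' : IsDimensionPolynomial K c h φ')
    (hspan : Submodule.span (WeylAlgebra K n) (Set.range f) ≤
      Submodule.span (WeylAlgebra K n) (Set.range h)) : EventuallyLE φ φ' := by
  rw [isDimensionPolynomial_iff] at hφ hφ'
  refine eventuallyLE_of_eval_eq_finrank_level (isMonomialAction_genAction f)
    (isMonomialAction_genAction h) (fun i => ?_) hφ hφ'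
  rw [monoSMul_zero]
  exact mem_span_range_monoSMul (hspan (Submodule.subset_span ⟨i, rfl⟩))

end Filtration

section Invariance

open MvPolynomial

lemma HasExpansion.totalDegree_le {n p : ℕ} {c : Fin n → Fin p} {φ : MvPolynomial (Fin p) ℚ}
    {a : (Fin p → ℕ) →₀ ℤ} (ha : HasExpansion c φ a) :
    φ.totalDegree ≤ ∑ j, 2 * blockSize c j := by
  rw [← weightedTotalDegree_one, weightedTotalDegree_le_iff ha.linearCombination]
  intro l hl
  rw [one_dotProduct]
  exact Finset.sum_le_sum fun j _ => ha.1 l hl j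

lemma degreeOf_eq_of_antisymmRel {p : ℕ} {φ ψ : MvPolynomial (Fin p) ℚ}
    (h : AntisymmRel EventuallyLE φ ψ) (j : Fin p) : φ.degreeOf j = ψ.degreeOf j :=
  (degreeOf_le_of_antisymmRel h j).antisymm (degreeOf_le_of_antisymmRel h.symm j)

end Invariance

end WeylDim

end

open WeylDim in
theorem theorem4p4_general (K : Type*) [Field K] (n p : ℕ) (c : Fin n → Fin p)
    (M : Type*) [AddCommGroup M] [Module K M] [Module (WeylAlgebra K n) M]
    [IsScalarTower K (WeylAlgebra K n) M] :
    (∀ (m : ℕ) (f : Fin m → M), (∃! φ, IsDimensionPolynomial K c f φ) ∧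
      ∀ φ, IsDimensionPolynomial K c f φ → ∃! a, HasExpansion c φ a) ∧
    (∀ (m q : ℕ) (f : Fin m → M) (h : Fin q → M),
      Submodule.span (WeylAlgebra K n) (Set.range f) =
        Submodule.span (WeylAlgebra K n) (Set.range h) →
      ∀ φ φ' a b, IsDimensionPolynomial K c f φ → HasExpansion c φ a →
        IsDimensionPolynomial K c h φ' → HasExpansion c φ' b →
        φ.totalDegree = φ'.totalDegree ∧
        a (fun j => 2 * blockSize c j) = b (fun j => 2 * blockSize c j) ∧
        ((∀ j, φ.degreeOf j = φ'.degreeOf j) ∧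
          a (fun j => φ.degreeOf j) = b (fun j => φ'.degreeOf j)) ∧
        (lexMaximal (a.support : Set (Fin p → ℕ)) = lexMaximal (b.support : Set (Fin p → ℕ)) ∧
          ∀ k ∈ lexMaximal (a.support : Set (Fin p → ℕ)), a k = b k) ∧
        (∀ k : Fin p → ℕ, ∑ j, k j = φ.totalDegree → a k = b k) ∧
        ∀ k : Fin p →₀ ℕ, ∑ j, k j = φ.totalDegree → φ.coeff k = φ'.coeff k) := by
  refine ⟨fun m f => ⟨existsUnique_isDimensionPolynomial c f, fun φ hφ =>
    existsUnique_hasExpansion hφ.mem_binomSpan⟩, fun m q f h hspan φ φ' a b hφ hφa hφ' hφb => ?_⟩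
  have equiv : AntisymmRel EventuallyLE φ φ' :=
    ⟨hφ.eventuallyLE hφ' hspan.le, hφ'.eventuallyLE hφ hspan.ge⟩
  have ha := hφa.linearCombination
  have hb := hφb.linearCombination
  have degreeOf_eq := degreeOf_eq_of_antisymmRel equiv
  refine ⟨totalDegree_eq_of_antisymmRel equiv,
    apply_eq_of_totalDegree_le equiv ha hb hφa.totalDegree_le, ⟨degreeOf_eq, ?_⟩,
    ⟨Set.ext fun k => ⟨fun hk => (apply_eq_and_mem_lexMaximal equiv ha hb hk).2,
      fun hk => (apply_eq_and_mem_lexMaximal equiv.symm hb ha hk).2⟩,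
      fun k hk => (apply_eq_and_mem_lexMaximal equiv ha hb hk).1⟩,
    fun k hk => apply_eq_of_totalDegree_le equiv ha hb hk.ge,
    fun k hk => coeff_eq_of_totalDegree_le equiv hk.ge⟩
  simp only [← degreeOf_eq]
  exact apply_eq_of_totalDegree_le equiv ha hb (totalDegree_le_sum_degreeOf φ)

theorem theorem4p4 (K : Type*) [Field K] [CharZero K] (n p : ℕ) (c : Fin n → Fin p)
    (M : Type*) [AddCommGroup M] [Module K M] [Module (WeylDim.WeylAlgebra K n) M]
    [IsScalarTower K (WeylDim.WeylAlgebra K n) M] :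
    -- every finite system of generators has exactly one dimension polynomial, and this has
    -- exactly one expansion in the binomial basis with integer coefficients
    (∀ (m : ℕ) (f : Fin m → M),
      Submodule.span (WeylDim.WeylAlgebra K n) (Set.range f) = ⊤ →
      (∃! φ : MvPolynomial (Fin p) ℚ, WeylDim.IsDimensionPolynomial K c f φ) ∧
      ∀ φ : MvPolynomial (Fin p) ℚ, WeylDim.IsDimensionPolynomial K c f φ →
        ∃! a : (Fin p → ℕ) →₀ ℤ, WeylDim.HasExpansion c φ a) ∧
    -- the invariants agree for any two finite systems of generators
    (∀ (m q : ℕ) (f : Fin m → M) (h : Fin q → M),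
      Submodule.span (WeylDim.WeylAlgebra K n) (Set.range f) = ⊤ →
      Submodule.span (WeylDim.WeylAlgebra K n) (Set.range h) = ⊤ →
      ∀ (φ φ' : MvPolynomial (Fin p) ℚ) (a b : (Fin p → ℕ) →₀ ℤ),
        WeylDim.IsDimensionPolynomial K c f φ → WeylDim.HasExpansion c φ a →
        WeylDim.IsDimensionPolynomial K c h φ' → WeylDim.HasExpansion c φ' b →
        φ.totalDegree = φ'.totalDegree ∧
        a (fun j => 2 * WeylDim.blockSize c j) = b (fun j => 2 * WeylDim.blockSize c j) ∧
        ((∀ j, φ.degreeOf j = φ'.degreeOf j) ∧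
          a (fun j => φ.degreeOf j) = b (fun j => φ'.degreeOf j)) ∧
        (WeylDim.lexMaximal (a.support : Set (Fin p → ℕ)) =
            WeylDim.lexMaximal (b.support : Set (Fin p → ℕ)) ∧
          ∀ k ∈ WeylDim.lexMaximal (a.support : Set (Fin p → ℕ)), a k = b k) ∧
        (∀ k : Fin p → ℕ, ∑ j, k j = φ.totalDegree → a k = b k) ∧
        ∀ k : Fin p →₀ ℕ, ∑ j, k j = φ.totalDegree → φ.coeff k = φ'.coeff k) := by
  have general := theorem4p4_general K n p c M
  exact ⟨fun m f _ => general.1 m f, fun m q f h hf hh => general.2 m q f h (hf.trans hh.symm)⟩
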